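/- Let $K$ be an algebraically closed field of characteristic $0$, let $G$ be a finite group acting linearly on a finite-dimensional $K$-vector space $Y$, and let $S=K[Y]=\bigoplus_{d\ge 0}S_d$ be the coordinate ring of $Y$ with its standard grading, so that the invariant ring $S^G=\bigoplus_{d\ge 0}(S^G)_d$ is a graded $K$-algebra. For a homogeneous ideal (that is, a graded $S^G$-submodule) $N\subseteq S^G$ let $H(N,t)=\sum_{d\ge 0}\dim_K(N\cap S_d)\,t^d\in\mathbb{Z}[[t]]$ be its Hilbert series. The universal denominator of $H(S^G,t)$ is the unique smallest (with respect to divisibility) polynomial $B(t)\in\mathbb{Z}[t]$ such that $B(0)=1$ and $B(t)H(N,t)$ is a polynomial for every homogeneous ideal $N\subseteq S^G$. Then the universal denominator of $H(S^G,t)$ exists, and, viewed in $K[t]$, it is equal to $$\operatorname{lcm}\{\det(\operatorname{id}-t\,g)\mid g\in G\},$$ the least common multiple in $K[t]$, normalized to have constant term $1$, of the determinants of the endomorphisms $\operatorname{id}-t\,g$ of $Y$, where $t$ is an indeterminate. -/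

import Mathlib

open Polynomial TensorProduct

noncomputable section

/-! ### Universal denominators of graded algebras -/

section UniversalDenominator

variable {K A : Type*} [Field K] [CommRing A] [Algebra K A]

/-- The Hilbert series `∑ d, dim (I ∩ A_d) t ^ d` of a homogeneous ideal `I` of an `ℕ`-graded
`K`-algebra `A = ⨁ d, A_d` with finite-dimensional homogeneous components. -/
def hilbertSeries (𝒜 : ℕ → Submodule K A) (I : Ideal A) : PowerSeries ℤ :=
  PowerSeries.mk fun d => (Module.finrank K ↥(I.restrictScalars K ⊓ 𝒜 d) : ℤ)

/-- `B(t)` has constant term `1`, and `B(t) H(I, t)` is a polynomial for every graded submodule `I`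
of the graded algebra `A`, regarded as a module over itself. All the Hilbert series in question
are power series, so "Laurent polynomial" and "polynomial" mean the same here. -/
def IsCommonDenominator (𝒜 : ℕ → Submodule K A) [GradedAlgebra 𝒜] (B : ℤ[X]) : Prop :=
  B.coeff 0 = 1 ∧
    ∀ I : Ideal A, I.IsHomogeneous 𝒜 →
      ∃ P : ℤ[X], (B : PowerSeries ℤ) * hilbertSeries 𝒜 I = (P : PowerSeries ℤ)

/-- `B(t)` is the universal denominator of `H(A, t)`: the smallest polynomial, with respect to
divisibility, among the common denominators of the Hilbert series of all graded submodules. -/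
def IsUniversalDenominator (𝒜 : ℕ → Submodule K A) [GradedAlgebra 𝒜] (B : ℤ[X]) : Prop :=
  IsCommonDenominator 𝒜 B ∧ ∀ B' : ℤ[X], IsCommonDenominator 𝒜 B' → B ∣ B'

theorem IsUniversalDenominator.unique {𝒜 : ℕ → Submodule K A} [GradedAlgebra 𝒜] {B B' : ℤ[X]}
    (h : IsUniversalDenominator 𝒜 B) (h' : IsUniversalDenominator 𝒜 B') : B = B' := by
  obtain ⟨u, hu⟩ := associated_of_dvd_dvd (h.2 B' h'.1) (h'.2 B h.1)
  obtain ⟨c, -, hc⟩ := Polynomial.isUnit_iff.1 u.isUnit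
  have h1 := h'.1.1
  rw [← hu, ← hc, Polynomial.coeff_mul_C, h.1.1, one_mul] at h1
  rw [← hu, ← hc, h1, map_one, mul_one]

end UniversalDenominator

/-- `m` is a least common multiple of the set `s`. -/
def IsLeastCommonMultiple {R : Type*} [CommRing R] (s : Set R) (m : R) : Prop :=
  (∀ a ∈ s, a ∣ m) ∧ ∀ n : R, (∀ a ∈ s, a ∣ n) → m ∣ n

/-! ### The coordinate ring of a vector space and its grading -/

section CoordinateRing

variable (K Y : Type*) [Field K] [AddCommGroup Y] [Module K Y]

/-- The coordinate ring `K[Y]`, as the symmetric algebra of the dual space. -/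
def CoordinateRing : Type _ := SymmetricAlgebra K (Module.Dual K Y)

instance : CommRing (CoordinateRing K Y) :=
  inferInstanceAs (CommRing (SymmetricAlgebra K (Module.Dual K Y)))

instance : Algebra K (CoordinateRing K Y) :=
  inferInstanceAs (Algebra K (SymmetricAlgebra K (Module.Dual K Y)))

/-- The linear forms on `Y`, as elements of `K[Y]`. -/
def linearForm : Module.Dual K Y →ₗ[K] CoordinateRing K Y :=
  SymmetricAlgebra.ι K (Module.Dual K Y)

variable {K Y} in
/-- The universal property of `K[Y]`: algebra maps out of it are determined by their values on
linear forms, which are arbitrary. -/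
def coordinateRingLift {A : Type*} [CommSemiring A] [Algebra K A] (φ : Module.Dual K Y →ₗ[K] A) :
    CoordinateRing K Y →ₐ[K] A :=
  SymmetricAlgebra.lift φ

variable {K Y} in
theorem coordinateRingLift_linearForm {A : Type*} [CommSemiring A] [Algebra K A]
    (φ : Module.Dual K Y →ₗ[K] A) (m : Module.Dual K Y) :
    coordinateRingLift φ (linearForm K Y m) = φ m :=
  SymmetricAlgebra.lift_ι_apply φ m

variable {K Y} in
theorem coordinateRing_algHom_ext {A : Type*} [CommSemiring A] [Algebra K A]
    {F F' : CoordinateRing K Y →ₐ[K] A}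
    (h : ∀ m, F (linearForm K Y m) = F' (linearForm K Y m)) : F = F' :=
  SymmetricAlgebra.algHom_ext (LinearMap.ext h)

/-- The space `K[Y]_d` of forms of degree `d`, spanned by the products of `d` linear forms. -/
def coordinateRingDegree (d : ℕ) : Submodule K (CoordinateRing K Y) :=
  LinearMap.range (linearForm K Y) ^ d

instance coordinateRing_gradedMonoid : SetLike.GradedMonoid (coordinateRingDegree K Y) :=
  Submodule.nat_power_gradedMonoid (LinearMap.range (linearForm K Y))

/-- The linear forms, placed in degree `1`. -/
def coordinateRingGradedι :
    Module.Dual K Y →ₗ[K] DirectSum ℕ fun d => ↥(coordinateRingDegree K Y d) :=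
  DirectSum.lof K ℕ (fun d => ↥(coordinateRingDegree K Y d)) 1 ∘ₗ
    (linearForm K Y).codRestrict _ fun m => by
      simp [coordinateRingDegree]

theorem coordinateRingGradedι_apply (m : Module.Dual K Y) :
    coordinateRingGradedι K Y m =
      DirectSum.of (fun d => ↥(coordinateRingDegree K Y d)) 1
        ⟨linearForm K Y m, by simp [coordinateRingDegree]⟩ :=
  rfl

instance coordinateRing_gradedAlgebra : GradedAlgebra (coordinateRingDegree K Y) :=
  GradedAlgebra.ofAlgHom _ (coordinateRingLift <| coordinateRingGradedι K Y)
    (by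
      refine coordinateRing_algHom_ext fun m => ?_
      rw [AlgHom.comp_apply, coordinateRingLift_linearForm, coordinateRingGradedι_apply,
        DirectSum.coeAlgHom_of, AlgHom.id_apply])
    fun i x => by
      obtain ⟨x, hx⟩ := x
      dsimp only [Subtype.coe_mk]
      unfold coordinateRingDegree at hx
      induction hx using Submodule.pow_induction_on_left' with
      | algebraMap r =>
        rw [AlgHom.commutes, DirectSum.algebraMap_apply]; rfl
      | add x y i hx hy ihx ihy =>
        rw [map_add, ihx, ihy, ← map_add]
        rfl
      | mem_mul m hm i x hx ih =>
        obtain ⟨_, rfl⟩ := hm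
        rw [map_mul, ih, coordinateRingLift_linearForm, coordinateRingGradedι_apply,
          DirectSum.of_mul_of]
        exact DirectSum.of_eq_of_gradedMonoid_eq (Sigma.subtype_ext (add_comm _ _) rfl)

end CoordinateRing

/-! ### Invariants -/

section Invariants

variable {K G Y : Type*} [Field K] [Group G] [AddCommGroup Y] [Module K Y]

/-- The action of `g` on `K[Y]`; on linear forms it is `f ↦ f ∘ g⁻¹`. -/
def coordinateRingAct (ρ : Representation K G Y) (g : G) :
    CoordinateRing K Y →ₐ[K] CoordinateRing K Y :=
  coordinateRingLift (linearForm K Y ∘ₗ ρ.dual g)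

/-- The invariant ring `K[Y]^G`. -/
def invariantRing (ρ : Representation K G Y) : Subalgebra K (CoordinateRing K Y) :=
  ⨅ g : G, AlgHom.equalizer (coordinateRingAct ρ g) (AlgHom.id K (CoordinateRing K Y))

/-- The space `(K[Y]^G)_d` of invariant forms of degree `d`. -/
def invariantRingDegree (ρ : Representation K G Y) (d : ℕ) : Submodule K ↥(invariantRing ρ) :=
  (coordinateRingDegree K Y d).comap (invariantRing ρ).val.toLinearMap

theorem mem_invariantRing {ρ : Representation K G Y} {f : CoordinateRing K Y} :
    f ∈ invariantRing ρ ↔ ∀ g, coordinateRingAct ρ g f = f := by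
  simp [invariantRing, Algebra.mem_iInf, AlgHom.mem_equalizer]

theorem coordinateRingAct_mem (ρ : Representation K G Y) (g : G) {d : ℕ}
    {f : CoordinateRing K Y} (hf : f ∈ coordinateRingDegree K Y d) :
    coordinateRingAct ρ g f ∈ coordinateRingDegree K Y d := by
  have h : (coordinateRingDegree K Y d).map (coordinateRingAct ρ g).toLinearMap ≤
      coordinateRingDegree K Y d := by
    unfold coordinateRingDegree
    rw [Submodule.map_pow]
    refine pow_le_pow_left' ?_ d
    rintro _ ⟨_, ⟨m, rfl⟩, rfl⟩
    exact ⟨ρ.dual g m, (coordinateRingLift_linearForm (linearForm K Y ∘ₗ ρ.dual g) m).symm⟩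
  exact h ⟨f, hf, rfl⟩

theorem decompose_mem_invariantRing (ρ : Representation K G Y) {f : CoordinateRing K Y}
    (hf : f ∈ invariantRing ρ) (d : ℕ) :
    (DirectSum.decompose (coordinateRingDegree K Y) f d : CoordinateRing K Y) ∈
      invariantRing ρ := by
  rw [mem_invariantRing] at hf ⊢
  intro g
  have key : ∀ f : CoordinateRing K Y,
      (DirectSum.decompose (coordinateRingDegree K Y) (coordinateRingAct ρ g f) d :
        CoordinateRing K Y) =
      coordinateRingAct ρ g (DirectSum.decompose (coordinateRingDegree K Y) f d) := by
    intro f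
    induction f using DirectSum.Decomposition.inductionOn (coordinateRingDegree K Y) with
    | zero => simp
    | @homogeneous i m =>
      by_cases h : i = d
      · subst h
        rw [DirectSum.decompose_of_mem_same _ (coordinateRingAct_mem ρ g m.2),
          DirectSum.decompose_of_mem_same _ m.2]
      · rw [DirectSum.decompose_of_mem_ne _ (coordinateRingAct_mem ρ g m.2) h,
          DirectSum.decompose_of_mem_ne _ m.2 h, map_zero]
    | add m m' h h' => simp [h, h']
  rw [← key, hf g]

instance invariantRing_gradedMonoid (ρ : Representation K G Y) :
    SetLike.GradedMonoid (invariantRingDegree ρ) where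
  one_mem := SetLike.GradedOne.one_mem (A := coordinateRingDegree K Y)
  mul_mem _ _ _ _ h h' := SetLike.GradedMul.mul_mem (A := coordinateRingDegree K Y) h h'

/-- The homogeneous components of an invariant. -/
def invariantRingDecompose (ρ : Representation K G Y) (f : invariantRing ρ) :
    DirectSum ℕ fun d => ↥(invariantRingDegree ρ d) := by
  classical
  exact DirectSum.mk (fun d => ↥(invariantRingDegree ρ d))
    (DirectSum.decompose (coordinateRingDegree K Y) (f : CoordinateRing K Y)).support
    fun d => ⟨⟨_, decompose_mem_invariantRing ρ f.2 d⟩,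
      (DirectSum.decompose (coordinateRingDegree K Y) (f : CoordinateRing K Y) d).2⟩

theorem invariantRingDecompose_apply (ρ : Representation K G Y) (f : invariantRing ρ) (d : ℕ) :
    ((invariantRingDecompose ρ f d : invariantRing ρ) : CoordinateRing K Y) =
      DirectSum.decompose (coordinateRingDegree K Y) (f : CoordinateRing K Y) d := by
  classical
  unfold invariantRingDecompose
  by_cases h : d ∈ (DirectSum.decompose (coordinateRingDegree K Y)
      (f : CoordinateRing K Y)).support
  · rw [DirectSum.mk_apply_of_mem h]
  · rw [DirectSum.mk_apply_of_notMem h]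
    rw [DFinsupp.notMem_support_iff] at h
    simp [h]

theorem decompose_coe_invariantRing (ρ : Representation K G Y)
    (x : DirectSum ℕ fun d => ↥(invariantRingDegree ρ d)) (d : ℕ) :
    (DirectSum.decompose (coordinateRingDegree K Y)
      ((DirectSum.coeAddMonoidHom (invariantRingDegree ρ) x : invariantRing ρ) :
        CoordinateRing K Y) d : CoordinateRing K Y) =
      ((x d : invariantRing ρ) : CoordinateRing K Y) := by
  induction x using DirectSum.induction_on with
  | zero =>
    rw [AddMonoidHom.map_zero, ZeroMemClass.coe_zero, DirectSum.decompose_zero]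
    rfl
  | of i m =>
    rw [DirectSum.coeAddMonoidHom_of]
    by_cases h : i = d
    · subst h
      have hm : ((m : invariantRing ρ) : CoordinateRing K Y) ∈ coordinateRingDegree K Y i := m.2
      rw [DirectSum.decompose_of_mem_same _ hm, DirectSum.of_eq_same]
    · have hm : ((m : invariantRing ρ) : CoordinateRing K Y) ∈ coordinateRingDegree K Y i := m.2
      rw [DirectSum.decompose_of_mem_ne _ hm h, DirectSum.of_eq_of_ne _ _ _ (Ne.symm h)]
      rfl
  | add x y hx hy =>
    rw [AddMonoidHom.map_add, Subalgebra.coe_add, DirectSum.decompose_add, DirectSum.add_apply,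
      Submodule.coe_add, hx, hy, DirectSum.add_apply]
    rfl

instance invariantRing_decomposition (ρ : Representation K G Y) :
    DirectSum.Decomposition (invariantRingDegree ρ) where
  decompose' := invariantRingDecompose ρ
  left_inv f := by
    apply Subtype.ext
    apply (DirectSum.decompose (coordinateRingDegree K Y)).injective
    refine DFinsupp.ext fun d => Subtype.ext ?_
    rw [decompose_coe_invariantRing, invariantRingDecompose_apply]
  right_inv x := by
    refine DFinsupp.ext fun d => Subtype.ext (Subtype.ext ?_)
    rw [invariantRingDecompose_apply, decompose_coe_invariantRing]

instance invariantRing_gradedAlgebra (ρ : Representation K G Y) :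
    GradedAlgebra (invariantRingDegree ρ) where

/-- `det (id - t g)`, computed over the polynomial ring `K[t]`. -/
def detOneSub (ρ : Representation K G Y) (g : G) : K[X] :=
  LinearMap.det (LinearMap.id - (X : K[X]) • (ρ g).baseChange K[X])

end Invariants

end

/-! ### Hilbert series under multiplication by a homogeneous element -/

section GradedReduction

variable {K A : Type*} [Field K] [CommRing A] [Algebra K A]

/-! For `w` in `K` let `M w` be the largest dimension of the `w`-eigenspace of an element of `G`.
Elements of `G` act semisimply, so `w` is a root of `det (id - t g)` of multiplicity the dimension
of the `w`-eigenspace of `g⁻¹`; hence the least common multiple has multiplicity exactly `M w` at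
each `w`. Since `M` vanishes off the `|G|`-th roots of unity and depends only on the order of `w`, a
product of cyclotomic polynomials, up to sign, is an integral `B` with these multiplicities. It
remains to see that `M w` is the largest order of a pole at `w` of the series `H(N, t)`.

Upper bound (`exists_denominator`). Invariant forms of degree `d` with `w ^ d ≠ 1` have as common
zeros only `w`-eigenvectors of group elements, because invariants separate orbits. Adding `M w`
invariants of degree `|G|` leaves only the zero vector, so by the Nullstellensatz these forms
generate an ideal containing all invariants of large degree. Then the product of the factors `1 - t
^ d` over their degrees is a common denominator, and only the `M w` factors `1 - t ^ |G|` can vanish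
at `w`, each to order at most one.

Lower bound (`finrank_eigenspace_le_rootMultiplicity`). Let `V` be the `w`-eigenspace of `g`, and
`F` the Hilbert series of the invariants modulo those vanishing on `V`. An invariant form of degree
`d` with `w ^ d ≠ 1` vanishes on `V`, so `F(w t) = F(t)` and the pole orders at `w` and `1` agree.
As `K[Y]` is generated over the invariants in bounded degree, a polynomial multiple of `F` dominates
the Hilbert series `(1 - t) ^ (-dim V)` of `K[V]`; hence the pole at `1` has order at least `dim V`.
-/

theorem Submodule.finrank_map_add_finrank_inf_ker {V V' : Type*} [AddCommGroup V] [Module K V]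
    [AddCommGroup V'] [Module K V'] (W : Submodule K V) [FiniteDimensional K W] (f : V →ₗ[K] V') :
    Module.finrank K (W.map f) + Module.finrank K ↥(W ⊓ LinearMap.ker f) =
      Module.finrank K W := by
  have h := LinearMap.finrank_range_add_finrank_ker (f.domRestrict W)
  rw [LinearMap.range_domRestrict] at h
  rw [← h]
  congr 1
  have e : W ⊓ LinearMap.ker f = (LinearMap.ker (f.domRestrict W)).map W.subtype := by
    ext x
    simp [LinearMap.domRestrict_apply, and_comm]
  rw [e]
  exact (Submodule.equivMapOfInjective _ W.injective_subtype _).finrank_eq.symm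

/-- The power series that are polynomials. -/
noncomputable abbrev polynomialSubring : Subring (PowerSeries ℤ) :=
  (Polynomial.coeToPowerSeries.ringHom (R := ℤ)).range

theorem mem_polynomialSubring {f : PowerSeries ℤ} :
    f ∈ polynomialSubring ↔ ∃ P : ℤ[X], f = (P : PowerSeries ℤ) := by
  simp [polynomialSubring, RingHom.mem_range, eq_comm]

theorem mem_polynomialSubring_of_coeff_eq_zero {f : PowerSeries ℤ} (n : ℕ)
    (h : ∀ d, n ≤ d → PowerSeries.coeff d f = 0) : f ∈ polynomialSubring := by
  refine mem_polynomialSubring.2 ⟨f.trunc n, ?_⟩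
  ext d
  rw [Polynomial.coeff_coe, PowerSeries.coeff_trunc]
  split_ifs with hd
  · rfl
  · exact h d (not_lt.1 hd)

theorem hilbertSeries_bot (𝒜 : ℕ → Submodule K A) : hilbertSeries 𝒜 (⊥ : Ideal A) = 0 := by
  ext d
  have : (⊥ : Ideal A).restrictScalars K ⊓ 𝒜 d = ⊥ := by simp
  rw [hilbertSeries, PowerSeries.coeff_mk, this]
  simp

variable (𝒜 : ℕ → Submodule K A) [GradedAlgebra 𝒜]

/-- The ideal of those elements of `N` that `a` multiplies into `N'`. -/
def annihilatedBy (N' N : Ideal A) (a : A) : Ideal A :=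
  N ⊓ Submodule.comap (LinearMap.mulLeft A a) N'

theorem mem_annihilatedBy {N' N : Ideal A} {a x : A} :
    x ∈ annihilatedBy N' N a ↔ x ∈ N ∧ a * x ∈ N' := by
  simp [annihilatedBy]

variable {𝒜}

theorem annihilatedBy_isHomogeneous {N' N : Ideal A} (hN' : N'.IsHomogeneous 𝒜)
    (hN : N.IsHomogeneous 𝒜) {a : A} {d : ℕ} (ha : a ∈ 𝒜 d) :
    (annihilatedBy N' N a).IsHomogeneous 𝒜 := by
  intro i x hx
  rw [mem_annihilatedBy] at hx ⊢
  refine ⟨hN i hx.1, ?_⟩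
  rw [← DirectSum.coe_decompose_mul_add_of_left_mem 𝒜 ha]
  exact hN' _ hx.2

theorem sup_span_mul_isHomogeneous {N' N : Ideal A} (hN' : N'.IsHomogeneous 𝒜)
    (hN : N.IsHomogeneous 𝒜) {a : A} {d : ℕ} (ha : a ∈ 𝒜 d) :
    (N' ⊔ Ideal.span {a} * N).IsHomogeneous 𝒜 := by
  refine hN'.sup (Ideal.IsHomogeneous.mul ?_ hN)
  refine Ideal.homogeneous_span 𝒜 _ ?_
  rintro x rfl
  exact ⟨d, ha⟩

/-- Rank-nullity for `x ↦ a * x` from `N` in degree `e` to `A ⧸ N'`: the kernel is `annihilatedBy N'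
N a`, and the image is that of `N' + a N` in degree `d + e`. -/
theorem finrank_sup_span_mul [∀ d, FiniteDimensional K (𝒜 d)] {N' N : Ideal A}
    (hN' : N'.IsHomogeneous 𝒜) (hN : N.IsHomogeneous 𝒜) {a : A} {d : ℕ} (ha : a ∈ 𝒜 d) (e : ℕ) :
    Module.finrank K ↥((N' ⊔ Ideal.span {a} * N).restrictScalars K ⊓ 𝒜 (d + e)) +
        Module.finrank K ↥((annihilatedBy N' N a).restrictScalars K ⊓ 𝒜 e) =
      Module.finrank K ↥(N.restrictScalars K ⊓ 𝒜 e) +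
        Module.finrank K ↥(N'.restrictScalars K ⊓ 𝒜 (d + e)) := by
  set f : A →ₗ[K] A ⧸ N'.restrictScalars K := (N'.restrictScalars K).mkQ
  have : ∀ (I : Ideal A) d, FiniteDimensional K ↥(I.restrictScalars K ⊓ 𝒜 d) := fun I d =>
    Submodule.finiteDimensional_of_le inf_le_right
  have h1 := Submodule.finrank_map_add_finrank_inf_ker
    ((N' ⊔ Ideal.span {a} * N).restrictScalars K ⊓ 𝒜 (d + e)) f
  have h2 := Submodule.finrank_map_add_finrank_inf_ker
    (N.restrictScalars K ⊓ 𝒜 e) (f ∘ₗ LinearMap.mulLeft K a)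
  have e1 : (N' ⊔ Ideal.span {a} * N).restrictScalars K ⊓ 𝒜 (d + e) ⊓ LinearMap.ker f =
      N'.restrictScalars K ⊓ 𝒜 (d + e) := by
    ext x
    simp only [f, Submodule.ker_mkQ, Submodule.mem_inf, Submodule.restrictScalars_mem]
    exact ⟨fun h => ⟨h.2, h.1.2⟩, fun h => ⟨⟨Ideal.mem_sup_left h.1, h.2⟩, h.1⟩⟩
  have e2 : N.restrictScalars K ⊓ 𝒜 e ⊓ LinearMap.ker (f ∘ₗ LinearMap.mulLeft K a) =
      (annihilatedBy N' N a).restrictScalars K ⊓ 𝒜 e := by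
    ext x
    simp only [f, LinearMap.ker_comp, Submodule.ker_mkQ, Submodule.mem_inf, Submodule.mem_comap,
      Submodule.restrictScalars_mem, mem_annihilatedBy, LinearMap.mulLeft_apply]
    tauto
  have e3 : ((N' ⊔ Ideal.span {a} * N).restrictScalars K ⊓ 𝒜 (d + e)).map f =
      (N.restrictScalars K ⊓ 𝒜 e).map (f ∘ₗ LinearMap.mulLeft K a) := by
    apply le_antisymm
    · rintro _ ⟨z, ⟨hz, hzd⟩, rfl⟩
      obtain ⟨n', hn', w, hw, rfl⟩ := Submodule.mem_sup.1 hz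
      obtain ⟨n, hn, rfl⟩ := Ideal.mem_span_singleton_mul.1 hw
      refine ⟨DirectSum.decompose 𝒜 n e, ⟨hN e hn, SetLike.coe_mem _⟩, ?_⟩
      rw [LinearMap.comp_apply, LinearMap.mulLeft_apply,
        ← DirectSum.coe_decompose_mul_add_of_left_mem 𝒜 ha]
      have h3 := DirectSum.decompose_of_mem_same 𝒜 hzd
      rw [DirectSum.decompose_add, DirectSum.add_apply, Submodule.coe_add] at h3
      rw [← h3, map_add, right_eq_add]
      exact (Submodule.Quotient.mk_eq_zero _).2 (hN' _ hn')
    · rintro _ ⟨n, ⟨hn, hnd⟩, rfl⟩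
      refine ⟨a * n, ⟨?_, SetLike.GradedMul.mul_mem ha hnd⟩, rfl⟩
      exact Ideal.mem_sup_right (Ideal.mul_mem_mul (Ideal.mem_span_singleton_self a) hn)
  rw [e1, e3] at h1
  rw [e2] at h2
  omega

theorem finrank_sup_span_mul_of_lt {N' N : Ideal A}
    (hN' : N'.IsHomogeneous 𝒜) {a : A} {d : ℕ} (ha : a ∈ 𝒜 d) {e : ℕ} (he : e < d) :
    (N' ⊔ Ideal.span {a} * N).restrictScalars K ⊓ 𝒜 e = N'.restrictScalars K ⊓ 𝒜 e := by
  apply le_antisymm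
  · rintro z ⟨hz, hzd⟩
    obtain ⟨n', hn', w, hw, rfl⟩ := Submodule.mem_sup.1 hz
    obtain ⟨n, hn, rfl⟩ := Ideal.mem_span_singleton_mul.1 hw
    refine ⟨?_, hzd⟩
    have h3 := DirectSum.decompose_of_mem_same 𝒜 hzd
    rw [DirectSum.decompose_add, DirectSum.add_apply, Submodule.coe_add,
      DirectSum.coe_decompose_mul_of_left_mem_of_not_le 𝒜 ha (not_le.2 he), add_zero] at h3
    rw [← h3]
    exact hN' _ hn'
  · exact inf_le_inf_right _ fun x hx => Ideal.mem_sup_left hx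

/-- For `N' ≤ N` this is the Euler characteristic of the kernel and cokernel of multiplication by
`a` on `N / N'`, with the kernel shifted by `d`. -/
theorem one_sub_X_pow_mul_hilbertSeries_sub [∀ d, FiniteDimensional K (𝒜 d)] {N' N : Ideal A}
    (hN' : N'.IsHomogeneous 𝒜) (hN : N.IsHomogeneous 𝒜) {a : A} {d : ℕ} (ha : a ∈ 𝒜 d) :
    (1 - PowerSeries.X ^ d) * (hilbertSeries 𝒜 N - hilbertSeries 𝒜 N') =
      (hilbertSeries 𝒜 N - hilbertSeries 𝒜 (N' ⊔ Ideal.span {a} * N)) -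
        PowerSeries.X ^ d * (hilbertSeries 𝒜 (annihilatedBy N' N a) - hilbertSeries 𝒜 N') := by
  ext e
  rw [sub_mul, one_mul]
  simp only [map_sub, PowerSeries.coeff_X_pow_mul', hilbertSeries, PowerSeries.coeff_mk]
  split_ifs with h
  · obtain ⟨e, rfl⟩ := Nat.exists_eq_add_of_le h
    have := finrank_sup_span_mul hN' hN ha e
    rw [Nat.add_sub_cancel_left]
    zify at this
    linarith
  · rw [finrank_sup_span_mul_of_lt hN' ha (not_le.1 h)]

/-- Each factor `1 - t ^ d` trades `N / N'` for the cokernel and kernel of multiplication by `a`,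
both killed by `a`. The set `T` records the elements already known to kill the quotient; once the
list is used up, `h` applies. -/
theorem list_prod_mul_hilbertSeries_sub_mem [∀ d, FiniteDimensional K (𝒜 d)]
    (L : List (A × ℕ)) (hL : ∀ p ∈ L, p.1 ∈ 𝒜 p.2) (T : Set A)
    (h : ∀ N' N : Ideal A, N'.IsHomogeneous 𝒜 → N.IsHomogeneous 𝒜 → N' ≤ N →
      (∀ a ∈ T, ∀ x ∈ N, a * x ∈ N') → (∀ p ∈ L, ∀ x ∈ N, p.1 * x ∈ N') →
      hilbertSeries 𝒜 N - hilbertSeries 𝒜 N' ∈ polynomialSubring) :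
    ∀ N' N : Ideal A, N'.IsHomogeneous 𝒜 → N.IsHomogeneous 𝒜 → N' ≤ N →
      (∀ a ∈ T, ∀ x ∈ N, a * x ∈ N') →
      (L.map fun p => (1 - PowerSeries.X ^ p.2 : PowerSeries ℤ)).prod *
        (hilbertSeries 𝒜 N - hilbertSeries 𝒜 N') ∈ polynomialSubring := by
  induction L generalizing T with
  | nil =>
    intro N' N hN' hN hle hT
    simpa using h N' N hN' hN hle hT (by simp)
  | cons p L ih =>
    intro N' N hN' hN hle hT
    obtain ⟨a, d⟩ := p
    have ha : a ∈ 𝒜 d := hL (a, d) (by simp)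
    have ih' := ih (fun p hp => hL p (by simp [hp])) (insert a T) (by
      intro M' M hM' hM hMle hMT hML
      refine h M' M hM' hM hMle (fun b hb => hMT b (Set.mem_insert_of_mem _ hb)) ?_
      intro p hp
      rcases List.mem_cons.1 hp with rfl | hp
      · exact hMT a (Set.mem_insert _ _)
      · exact hML p hp)
    have h1 := ih' (N' ⊔ Ideal.span {a} * N) N (sup_span_mul_isHomogeneous hN' hN ha) hN
      (sup_le hle Ideal.mul_le_right) (by
        rintro b (rfl | hb) x hx
        · exact Ideal.mem_sup_right (Ideal.mul_mem_mul (Ideal.mem_span_singleton_self b) hx)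
        · exact Ideal.mem_sup_left (hT b hb x hx))
    have h2 := ih' N' (annihilatedBy N' N a) hN' (annihilatedBy_isHomogeneous hN' hN ha)
      (fun x hx => mem_annihilatedBy.2 ⟨hle hx, N'.mul_mem_left _ hx⟩) (by
        rintro b (rfl | hb) x hx
        · exact (mem_annihilatedBy.1 hx).2
        · exact hT b hb x (mem_annihilatedBy.1 hx).1)
    rw [List.map_cons, List.prod_cons, mul_comm (1 - _), mul_assoc,
      one_sub_X_pow_mul_hilbertSeries_sub hN' hN ha, mul_sub, mul_left_comm]
    refine sub_mem h1 (mul_mem (pow_mem ?_ _) h2)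
    exact mem_polynomialSubring.2 ⟨X, by simp⟩

/-- For `c` of degree `i`, the component is `c` times the component of `x` in degree `e - i`. Either
`i ≥ n` and `c ∈ I`, or `e - i > m` and the second factor is zero. -/
theorem decompose_mul_mem_mul {I N : Ideal A} (hN : N.IsHomogeneous 𝒜) {n m : ℕ}
    (hI : ∀ d, n ≤ d → ∀ c ∈ 𝒜 d, c ∈ I) {x : A} (hx : x ∈ N)
    (hxm : ∀ j, m < j → (DirectSum.decompose 𝒜 x j : A) = 0) (c : A) {e : ℕ} (he : m + n ≤ e) :
    (DirectSum.decompose 𝒜 (c * x) e : A) ∈ I * N := by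
  induction c using DirectSum.Decomposition.inductionOn 𝒜 with
  | zero => simp
  | @homogeneous i c =>
    by_cases hie : i ≤ e
    · rw [DirectSum.coe_decompose_mul_of_left_mem_of_le 𝒜 c.2 hie]
      by_cases hin : n ≤ i
      · exact Ideal.mul_mem_mul (hI i hin _ c.2) (hN _ hx)
      · rw [hxm _ (by omega), mul_zero]
        exact zero_mem _
    · rw [DirectSum.coe_decompose_mul_of_left_mem_of_not_le 𝒜 c.2 hie]
      exact zero_mem _
  | add c c' h h' =>
    rw [add_mul, DirectSum.decompose_add, DirectSum.add_apply, Submodule.coe_add]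
    exact add_mem h h'

theorem exists_decompose_eq_zero (s : Finset A) :
    ∃ m, ∀ x ∈ s, ∀ j, m < j → (DirectSum.decompose 𝒜 x j : A) = 0 := by
  classical
  refine ⟨s.sup fun x => (DirectSum.decompose 𝒜 x).support.sup id, fun x hx j hj => ?_⟩
  by_contra hne
  have h1 : j ∈ (DirectSum.decompose 𝒜 x).support := by
    rw [DFinsupp.mem_support_iff]
    exact fun h0 => hne (by rw [h0]; rfl)
  have h2 : j ≤ (DirectSum.decompose 𝒜 x).support.sup id := Finset.le_sup (f := id) h1
  have h3 := Finset.le_sup (f := fun x => (DirectSum.decompose 𝒜 x).support.sup id) hx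
  exact absurd hj (not_lt.2 (h2.trans h3))

/-- Generators of `N` live in degrees at most some `m`, so from degree `m + n` on `N` lies in `I *
N`, hence in `N'`: the two series differ in finitely many terms. -/
theorem hilbertSeries_sub_mem_of_mul_le [IsNoetherianRing A] {I : Ideal A} {n : ℕ}
    (hI : ∀ d, n ≤ d → ∀ c ∈ 𝒜 d, c ∈ I) {N' N : Ideal A} (hN : N.IsHomogeneous 𝒜)
    (hle : N' ≤ N) (h : I * N ≤ N') :
    hilbertSeries 𝒜 N - hilbertSeries 𝒜 N' ∈ polynomialSubring := by
  obtain ⟨s, hs⟩ := IsNoetherian.noetherian N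
  obtain ⟨m, hm⟩ := exists_decompose_eq_zero (𝒜 := 𝒜) s
  refine mem_polynomialSubring_of_coeff_eq_zero (m + n) fun e he => ?_
  have : N.restrictScalars K ⊓ 𝒜 e = N'.restrictScalars K ⊓ 𝒜 e := by
    apply le_antisymm
    · rintro x ⟨hx, hxe⟩
      refine ⟨h ?_, hxe⟩
      rw [← DirectSum.decompose_of_mem_same 𝒜 hxe]
      have hx' : x ∈ Submodule.span A (s : Set A) := hs.symm ▸ hx
      obtain ⟨c, -, rfl⟩ := Submodule.mem_span_finset.1 hx'
      rw [DirectSum.decompose_sum, DFinsupp.finsetSum_apply, AddSubmonoidClass.coe_finsetSum]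
      refine sum_mem fun y hy => ?_
      exact decompose_mul_mem_mul hN hI (hs ▸ Submodule.subset_span hy) (hm y hy) _ he
    · exact inf_le_inf_right _ hle
  rw [map_sub, hilbertSeries, hilbertSeries, PowerSeries.coeff_mk, PowerSeries.coeff_mk, this,
    sub_self]

/-- If the ideal generated by the homogeneous elements `a` with `(a, d) ∈ L` contains all forms of
large degree, then `∏ (1 - t ^ d)` is a common denominator. -/
theorem list_prod_mul_hilbertSeries_mem [IsNoetherianRing A] [∀ d, FiniteDimensional K (𝒜 d)]
    (L : List (A × ℕ)) (hL : ∀ p ∈ L, p.1 ∈ 𝒜 p.2) {n : ℕ}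
    (hn : ∀ d, n ≤ d → ∀ c ∈ 𝒜 d, c ∈ Ideal.span {a | ∃ p ∈ L, p.1 = a})
    (N : Ideal A) (hN : N.IsHomogeneous 𝒜) :
    (L.map fun p => (1 - PowerSeries.X ^ p.2 : PowerSeries ℤ)).prod * hilbertSeries 𝒜 N ∈
      polynomialSubring := by
  have := list_prod_mul_hilbertSeries_sub_mem (𝒜 := 𝒜) L hL ∅ (by
    intro N' N hN' hN hle _ hLN
    refine hilbertSeries_sub_mem_of_mul_le hn hN hle (Ideal.mul_le.2 fun r hr x hx => ?_)
    induction hr using Submodule.span_induction with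
    | mem a ha =>
      obtain ⟨p, hp, rfl⟩ := ha
      exact hLN p hp x hx
    | zero => simp
    | add a b _ _ h h' =>
      rw [add_mul]
      exact add_mem h h'
    | smul c a _ h =>
      rw [smul_eq_mul, mul_assoc]
      exact N'.mul_mem_left _ h) ⊥ N (Ideal.IsHomogeneous.bot 𝒜) hN bot_le (by simp)
  rwa [hilbertSeries_bot, sub_zero] at this

end GradedReduction

/-! ### Polynomial functions and the Nullstellensatz -/

section Evaluation

variable {K Y : Type*} [Field K] [AddCommGroup Y] [Module K Y]

/-- Evaluation of polynomial functions at a point. -/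
noncomputable def evalAt (y : Y) : CoordinateRing K Y →ₐ[K] K :=
  coordinateRingLift (Module.Dual.eval K Y y)

@[simp]
theorem evalAt_linearForm (y : Y) (m : Module.Dual K Y) : evalAt y (linearForm K Y m) = m y := by
  rw [evalAt, coordinateRingLift_linearForm, Module.Dual.eval_apply]

theorem evalAt_smul (c : K) (y : Y) {d : ℕ} {f : CoordinateRing K Y}
    (hf : f ∈ coordinateRingDegree K Y d) : evalAt (c • y) f = c ^ d * evalAt y f := by
  unfold coordinateRingDegree at hf
  induction hf using Submodule.pow_induction_on_left' with
  | algebraMap r => simp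
  | add f f' i _ _ h h' => rw [map_add, map_add, h, h', mul_add]
  | mem_mul m hm i f _ h =>
    obtain ⟨m, rfl⟩ := hm
    rw [map_mul, map_mul, h, evalAt_linearForm, evalAt_linearForm, map_smul, smul_eq_mul, pow_succ]
    ring

/-- A basis of `Y` identifies `K[Y]` with a polynomial ring. -/
noncomputable def coordinateRingEquiv {ι : Type*} [Finite ι] [DecidableEq ι]
    (b : Module.Basis ι K Y) : CoordinateRing K Y ≃ₐ[K] MvPolynomial ι K :=
  SymmetricAlgebra.equivMvPolynomial b.dualBasis

theorem coordinateRingEquiv_symm_X {ι : Type*} [Finite ι] [DecidableEq ι]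
    (b : Module.Basis ι K Y) (i : ι) :
    (coordinateRingEquiv b).symm (MvPolynomial.X i) = linearForm K Y (b.dualBasis i) :=
  SymmetricAlgebra.equivMvPolynomial_symm_X b.dualBasis i

theorem evalAt_coordinateRingEquiv_symm {ι : Type*} [Finite ι] [DecidableEq ι]
    (b : Module.Basis ι K Y) (y : Y) (p : MvPolynomial ι K) :
    evalAt y ((coordinateRingEquiv b).symm p) = MvPolynomial.aeval (b.repr y) p := by
  have : (evalAt y).comp ((coordinateRingEquiv b).symm : MvPolynomial ι K →ₐ[K] _) =
      MvPolynomial.aeval (b.repr y) := by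
    refine MvPolynomial.algHom_ext fun i => ?_
    rw [AlgHom.comp_apply, AlgEquiv.coe_toAlgHom, coordinateRingEquiv_symm_X, evalAt_linearForm,
      MvPolynomial.aeval_X, Module.Basis.dualBasis_apply]
  exact DFunLike.congr_fun this p

theorem coordinateRingDegree_mem_span_pow {d : ℕ} {f : CoordinateRing K Y}
    (hf : f ∈ coordinateRingDegree K Y d) :
    f ∈ Ideal.span (Set.range (linearForm K Y)) ^ d := by
  unfold coordinateRingDegree at hf
  induction hf using Submodule.pow_induction_on_left' with
  | algebraMap r => simp
  | add f f' i _ _ h h' => exact add_mem h h'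
  | mem_mul m hm i f _ h =>
    obtain ⟨m, rfl⟩ := hm
    rw [Nat.succ_eq_add_one, pow_succ']
    exact Ideal.mul_mem_mul (Ideal.subset_span ⟨m, rfl⟩) h

variable [FiniteDimensional K Y]

instance coordinateRing_isNoetherianRing : IsNoetherianRing (CoordinateRing K Y) :=
  isNoetherianRing_of_ringEquiv _ (coordinateRingEquiv (Module.finBasis K Y)).symm.toRingEquiv

instance coordinateRingDegree_finiteDimensional (d : ℕ) :
    FiniteDimensional K (coordinateRingDegree K Y d) := by
  refine Module.Finite.iff_fg.2 (Submodule.FG.pow (Module.Finite.iff_fg.1 ?_) d)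
  infer_instance

/-- The Nullstellensatz for `K[Y]`. -/
theorem mem_radical_of_evalAt_eq_zero [IsAlgClosed K] {J : Ideal (CoordinateRing K Y)}
    {f : CoordinateRing K Y}
    (h : ∀ y : Y, (∀ a ∈ J, evalAt y a = 0) → evalAt y f = 0) : f ∈ J.radical := by
  set b := Module.finBasis K Y
  set e := coordinateRingEquiv b
  have he : ∀ y a, evalAt y a = MvPolynomial.aeval (b.repr y) (e a) := fun y a => by
    rw [← evalAt_coordinateRingEquiv_symm, AlgEquiv.symm_apply_apply]
  have key : e f ∈ (J.comap (e.symm : MvPolynomial _ K →+* CoordinateRing K Y)).radical := by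
    rw [← MvPolynomial.vanishingIdeal_zeroLocus_eq_radical (K := K)]
    intro x hx
    have hy := h (b.equivFun.symm x) fun a ha => by
      have := hx (e a) (by simpa using ha)
      rw [he]
      convert this
      rw [← b.equivFun_apply, LinearEquiv.apply_symm_apply]
    rw [he] at hy
    convert hy
    rw [← b.equivFun_apply, LinearEquiv.apply_symm_apply]
  obtain ⟨n, hn⟩ := key
  refine ⟨n, ?_⟩
  rw [Ideal.mem_comap] at hn
  simpa using hn

/-- All linear forms vanish on the zero set of `J`, so they lie in its radical, and a power of the
finitely generated ideal they span lies in `J`. -/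
theorem exists_coordinateRingDegree_le [IsAlgClosed K] {J : Ideal (CoordinateRing K Y)}
    (h : ∀ y : Y, (∀ a ∈ J, evalAt y a = 0) → y = 0) :
    ∃ n, ∀ d, n ≤ d → ∀ f ∈ coordinateRingDegree K Y d, f ∈ J := by
  have hr : Ideal.span (Set.range (linearForm K Y)) ≤ J.radical := by
    rw [Ideal.span_le]
    rintro _ ⟨m, rfl⟩
    refine mem_radical_of_evalAt_eq_zero fun y hy => ?_
    rw [h y hy, evalAt_linearForm, map_zero]
  obtain ⟨n, hn⟩ := Ideal.exists_pow_le_of_le_radical_of_fg hr (IsNoetherian.noetherian _)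
  exact ⟨n, fun d hd f hf => hn (Ideal.pow_le_pow_right hd (coordinateRingDegree_mem_span_pow hf))⟩

end Evaluation

/-! ### Norms and averages over the group -/

section InvariantTheory

variable {K G Y : Type*} [Field K] [Group G] [AddCommGroup Y] [Module K Y]
  (ρ : Representation K G Y)

theorem coordinateRingAct_linearForm (g : G) (m : Module.Dual K Y) :
    coordinateRingAct ρ g (linearForm K Y m) = linearForm K Y (ρ.dual g m) :=
  coordinateRingLift_linearForm _ m

theorem coordinateRingAct_mul_apply (g h : G) (f : CoordinateRing K Y) :
    coordinateRingAct ρ (g * h) f = coordinateRingAct ρ g (coordinateRingAct ρ h f) := by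
  have : coordinateRingAct ρ (g * h) = (coordinateRingAct ρ g).comp (coordinateRingAct ρ h) := by
    refine coordinateRing_algHom_ext fun m => ?_
    rw [AlgHom.comp_apply]
    simp only [coordinateRingAct_linearForm, map_mul, Module.End.mul_apply]
  rw [this, AlgHom.comp_apply]

theorem evalAt_coordinateRingAct (g : G) (y : Y) (f : CoordinateRing K Y) :
    evalAt y (coordinateRingAct ρ g f) = evalAt (ρ g⁻¹ y) f := by
  have : (evalAt y).comp (coordinateRingAct ρ g) = evalAt (K := K) (ρ g⁻¹ y) := by
    refine coordinateRing_algHom_ext fun m => ?_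
    rw [AlgHom.comp_apply, coordinateRingAct_linearForm, evalAt_linearForm, evalAt_linearForm,
      Representation.dual_apply, Module.Dual.transpose_apply, LinearMap.comp_apply]
  rw [← this, AlgHom.comp_apply]

variable {ρ} in
theorem evalAt_apply_of_mem_invariantRing {f : CoordinateRing K Y} (hf : f ∈ invariantRing ρ)
    (g : G) (y : Y) : evalAt (ρ g y) f = evalAt y f := by
  have := evalAt_coordinateRingAct ρ g⁻¹ y f
  rwa [mem_invariantRing.1 hf, inv_inv, eq_comm] at this

variable [Fintype G]

/-- The product of all the translates of a function. -/
noncomputable def invariantNorm (f : CoordinateRing K Y) : CoordinateRing K Y :=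
  ∏ g : G, coordinateRingAct ρ g f

theorem invariantNorm_mem (f : CoordinateRing K Y) : invariantNorm ρ f ∈ invariantRing ρ := by
  rw [mem_invariantRing]
  intro h
  rw [invariantNorm, map_prod]
  refine Fintype.prod_equiv (Equiv.mulLeft h) _ _ fun g => ?_
  rw [Equiv.coe_mulLeft, coordinateRingAct_mul_apply]

theorem evalAt_invariantNorm (f : CoordinateRing K Y) (y : Y) :
    evalAt y (invariantNorm ρ f) = ∏ g : G, evalAt (ρ g y) f := by
  rw [invariantNorm, map_prod]
  refine Fintype.prod_equiv (Equiv.inv G) _ _ fun g => ?_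
  rw [evalAt_coordinateRingAct, Equiv.inv_apply]

theorem invariantNorm_linearForm_mem (m : Module.Dual K Y) :
    invariantNorm ρ (linearForm K Y m) ∈ coordinateRingDegree K Y (Fintype.card G) := by
  have := SetLike.prod_mem_graded (coordinateRingDegree K Y) (F := Finset.univ)
    (fun _ : G => 1) (fun g => coordinateRingAct ρ g (linearForm K Y m)) (fun g _ =>
      coordinateRingAct_mem ρ g (by simp [coordinateRingDegree]))
  simpa [invariantNorm] using this

/-- The average of the translates of a function. -/
noncomputable def reynolds (f : CoordinateRing K Y) : CoordinateRing K Y :=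
  (Fintype.card G : K)⁻¹ • ∑ g : G, coordinateRingAct ρ g f

theorem reynolds_mem (f : CoordinateRing K Y) : reynolds ρ f ∈ invariantRing ρ := by
  refine Subalgebra.smul_mem _ (mem_invariantRing.2 fun h => ?_) _
  rw [map_sum]
  refine Fintype.sum_equiv (Equiv.mulLeft h) _ _ fun g => ?_
  rw [Equiv.coe_mulLeft, coordinateRingAct_mul_apply]

variable {ρ} in
theorem reynolds_mul {a : CoordinateRing K Y} (ha : a ∈ invariantRing ρ)
    (f : CoordinateRing K Y) : reynolds ρ (a * f) = a * reynolds ρ f := by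
  simp only [reynolds, map_mul, mem_invariantRing.1 ha, ← Finset.mul_sum, mul_smul_comm]

theorem reynolds_add (f f' : CoordinateRing K Y) :
    reynolds ρ (f + f') = reynolds ρ f + reynolds ρ f' := by
  simp only [reynolds, map_add, Finset.sum_add_distrib, smul_add]

variable [CharZero K]

variable {ρ} in
theorem reynolds_eq_self {f : CoordinateRing K Y} (hf : f ∈ invariantRing ρ) :
    reynolds ρ f = f := by
  have : (Fintype.card G : K) ≠ 0 := Nat.cast_ne_zero.2 Fintype.card_ne_zero
  simp only [reynolds, mem_invariantRing.1 hf, Finset.sum_const, Finset.card_univ]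
  rw [← Nat.cast_smul_eq_nsmul K, smul_smul, inv_mul_cancel₀ this, one_smul]

end InvariantTheory

instance invariantRingDegree_finiteDimensional {K G Y : Type*} [Field K] [Group G]
    [AddCommGroup Y] [Module K Y] (ρ : Representation K G Y) [FiniteDimensional K Y] (d : ℕ) :
    FiniteDimensional K (invariantRingDegree ρ d) :=
  FiniteDimensional.of_injective
    ((invariantRing ρ).val.toLinearMap.restrict
      (p := invariantRingDegree ρ d) (q := coordinateRingDegree K Y d) fun _ h => h)
    fun _ _ h => Subtype.ext (Subtype.ext
      (congrArg (fun z : coordinateRingDegree K Y d => (z : CoordinateRing K Y)) h))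

/-! ### Ideals of invariants and separation of orbits -/

section FiniteGroup

variable {K G Y : Type*} [Field K] [Group G] [AddCommGroup Y] [Module K Y]
  (ρ : Representation K G Y)

variable [CharZero K] [Finite G]

/-- Averaging is linear over the invariants and fixes them, so it carries the extended ideal back
into `I`. The auxiliary factor `s` in `key` makes the claim stable under multiplication by arbitrary
polynomials. -/
theorem mem_of_mem_map_invariantRing (I : Ideal (invariantRing ρ)) (f : invariantRing ρ)
    (hf : (f : CoordinateRing K Y) ∈ I.map (algebraMap (invariantRing ρ) (CoordinateRing K Y))) :
    f ∈ I := by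
  have := Fintype.ofFinite G
  have key : ∀ x ∈ I.map (algebraMap (invariantRing ρ) (CoordinateRing K Y)),
      ∀ s : CoordinateRing K Y, (⟨reynolds ρ (s * x), reynolds_mem ρ _⟩ : invariantRing ρ) ∈ I := by
    intro x hx
    induction hx using Submodule.span_induction with
    | mem x hx =>
      obtain ⟨a, ha, rfl⟩ := hx
      intro s
      convert I.mul_mem_right ⟨reynolds ρ s, reynolds_mem ρ s⟩ ha
      change reynolds ρ (s * a) = a * reynolds ρ s
      rw [mul_comm, reynolds_mul a.2]
    | zero =>
      intro s
      convert I.zero_mem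
      simp [reynolds]
    | add x y _ _ h h' =>
      intro s
      convert I.add_mem (h s) (h' s)
      rw [mul_add, reynolds_add]
      rfl
    | smul c x _ h =>
      intro s
      rw [smul_eq_mul, ← mul_assoc]
      exact h _
  have h1 := key _ hf 1
  rw [one_mul] at h1
  convert h1
  exact (reynolds_eq_self f.2).symm

theorem comap_map_invariantRing (I : Ideal (invariantRing ρ)) :
    (I.map (algebraMap (invariantRing ρ) (CoordinateRing K Y))).comap
      (algebraMap (invariantRing ρ) (CoordinateRing K Y)) = I :=
  le_antisymm (fun f hf => mem_of_mem_map_invariantRing ρ I f hf) Ideal.le_comap_map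

theorem exists_evalAt_ne_of_forall_ne {y z : Y} (h : ∀ g, ρ g y ≠ z) :
    ∃ f ∈ invariantRing ρ, evalAt y f ≠ evalAt z f := by
  have := Fintype.ofFinite G
  -- Over an infinite field one linear form is nonzero at finitely many given nonzero vectors, so
  -- `m` separates every translate of `z` from every translate of `y`. Then `u` vanishes at `y` and
  -- at no translate of `z`, and its norm is the required invariant.
  obtain ⟨m, hm⟩ := Module.exists_dual_forall_apply_ne_zero (K := K)
    (fun p : G × G => ρ p.1 z - ρ p.2 y) (by
      rintro ⟨g, g'⟩ h0
      refine h (g⁻¹ * g') ?_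
      rw [map_mul, Module.End.mul_apply, ← sub_eq_zero.1 h0, ← Module.End.mul_apply, ← map_mul,
        inv_mul_cancel, map_one, Module.End.one_apply])
  set u : CoordinateRing K Y := ∏ g : G, (linearForm K Y m - algebraMap K _ (m (ρ g y)))
  have hu : ∀ x, evalAt x u = ∏ g : G, (m x - m (ρ g y)) := fun x => by simp [u, map_prod]
  refine ⟨invariantNorm ρ u, invariantNorm_mem ρ u, ?_⟩
  rw [evalAt_invariantNorm, evalAt_invariantNorm,
    Finset.prod_eq_zero (Finset.mem_univ (1 : G)) ?_]
  · refine (Finset.prod_ne_zero_iff.2 fun g _ => ?_).symm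
    rw [hu]
    refine Finset.prod_ne_zero_iff.2 fun g' _ => ?_
    rw [← map_sub]
    exact hm (g, g')
  · rw [hu]
    exact Finset.prod_eq_zero (Finset.mem_univ (1 : G)) (sub_self _)

/-- The common zeros of the invariant forms whose degree `d` satisfies `w ^ d ≠ 1` are
eigenvectors with eigenvalue `w` of elements of the group. -/
theorem exists_apply_eq_smul {w : K} {y : Y}
    (h : ∀ d, w ^ d ≠ 1 → ∀ a ∈ invariantRingDegree ρ d, evalAt y (a : CoordinateRing K Y) = 0) :
    ∃ g, ρ g y = w • y := by
  -- If `w • y` were outside the orbit of `y`, some invariant `f` would separate them; but its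
  -- degree `d` component is multiplied by `w ^ d`, which matters only where that component vanishes
  -- at `y`.
  by_contra! hne
  obtain ⟨f, hf, hf'⟩ := exists_evalAt_ne_of_forall_ne ρ hne
  apply hf'
  classical
  conv_lhs => rw [← DirectSum.sum_support_decompose (coordinateRingDegree K Y) f]
  conv_rhs => rw [← DirectSum.sum_support_decompose (coordinateRingDegree K Y) f]
  rw [map_sum, map_sum]
  refine Finset.sum_congr rfl fun d _ => ?_
  rw [evalAt_smul w y (SetLike.coe_mem _)]
  by_cases hd : w ^ d = 1
  · rw [hd, one_mul]
  · have := h d hd ⟨_, decompose_mem_invariantRing ρ hf d⟩ (SetLike.coe_mem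
      (DirectSum.decompose (coordinateRingDegree K Y) f d))
    rw [this, mul_zero]

variable [FiniteDimensional K Y]

/-- Extension of ideals to `K[Y]` is injective, having contraction as a left inverse, so the
ascending chain condition descends. -/
instance invariantRing_isNoetherianRing : IsNoetherianRing (invariantRing ρ) := by
  have hinj : Function.Injective
      (Ideal.map (algebraMap (invariantRing ρ) (CoordinateRing K Y))) :=
    Function.LeftInverse.injective (comap_map_invariantRing ρ)
  have hmono : StrictMono (Ideal.map (algebraMap (invariantRing ρ) (CoordinateRing K Y))) :=
    Monotone.strictMono_of_injective (fun _ _ => Ideal.map_mono) hinj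
  have h : WellFoundedGT (Ideal (CoordinateRing K Y)) := isNoetherian_iff'.1 inferInstance
  exact isNoetherian_iff'.2 hmono.wellFoundedGT

/-- For finitely many subspaces of dimension at most `m` there are `m` invariant forms of degree
`|G|` without common zeros in these subspaces other than `0`. -/
theorem exists_invariants_separating (m : ℕ) (𝒲 : Set (Submodule K Y)) (h𝒲 : 𝒲.Finite)
    (hm : ∀ W ∈ 𝒲, Module.finrank K W ≤ m) :
    ∃ θ : Fin m → invariantRing ρ, (∀ j, θ j ∈ invariantRingDegree ρ (Nat.card G)) ∧
      ∀ W ∈ 𝒲, ∀ y ∈ W, (∀ j, evalAt y (θ j : CoordinateRing K Y) = 0) → y = 0 := by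
  have := Fintype.ofFinite G
  induction m generalizing 𝒲 with
  | zero =>
    refine ⟨Fin.elim0, fun j => j.elim0, fun W hW y hy _ => ?_⟩
    have := Submodule.finrank_eq_zero.1 (Nat.le_zero.1 (hm W hW))
    rwa [this, Submodule.mem_bot] at hy
  | succ m ih =>
    have hex : ∀ W : {W // W ∈ 𝒲 ∧ W ≠ ⊥}, ∃ w ∈ W.1, w ≠ 0 := fun W =>
      Submodule.exists_mem_ne_zero_of_ne_bot W.2.2
    choose w hw hw0 using hex
    have : Finite {W // W ∈ 𝒲 ∧ W ≠ ⊥} := (h𝒲.subset fun W h => h.1 : {W | W ∈ 𝒲 ∧ W ≠ ⊥}.Finite)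
    -- The norm of `l` vanishes on `W` exactly along the sections of `W` by the kernels of `l ∘ₗ ρ
    -- g`. Avoiding a chosen nonzero vector in each nonzero `W` makes all of them proper, so the
    -- dimension drops and induction applies to this larger finite family.
    obtain ⟨l, hl⟩ := Module.exists_dual_forall_apply_ne_zero (K := K)
      (fun p : G × {W // W ∈ 𝒲 ∧ W ≠ ⊥} => ρ p.1 (w p.2)) (by
        rintro ⟨g, W⟩ h0
        apply hw0 W
        have := congrArg (ρ g⁻¹) h0
        simpa using this)
    obtain ⟨θ, hθ, hθ'⟩ := ih
      (Set.image2 (fun (W : Submodule K Y) (g : G) => W ⊓ LinearMap.ker (l ∘ₗ ρ g)) 𝒲 Set.univ)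
      (h𝒲.image2 _ Set.finite_univ) (by
        rintro _ ⟨W, hW, g, -, rfl⟩
        by_cases hW0 : W = ⊥
        · subst hW0
          have : Module.finrank K ↥(⊥ ⊓ LinearMap.ker (l ∘ₗ ρ g)) = 0 := by
            rw [bot_inf_eq, finrank_bot]
          exact this.trans_le (Nat.zero_le m)
        · refine Nat.le_of_lt_succ (lt_of_lt_of_le (Submodule.finrank_lt_finrank_of_lt ?_) (hm W hW))
          refine lt_of_le_of_ne inf_le_left fun heq => hl (g, ⟨W, hW, hW0⟩) ?_
          exact (heq.ge (hw ⟨W, hW, hW0⟩)).2)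
    refine ⟨Fin.cons ⟨_, invariantNorm_mem ρ (linearForm K Y l)⟩ θ, ?_, ?_⟩
    · intro j
      refine Fin.cases ?_ (fun j => ?_) j
      · rw [Nat.card_eq_fintype_card]
        exact invariantNorm_linearForm_mem ρ l
      · exact hθ j
    · intro W hW y hy h
      have h0 := h 0
      rw [Fin.cons_zero, evalAt_invariantNorm, Finset.prod_eq_zero_iff] at h0
      obtain ⟨g, -, hg⟩ := h0
      rw [evalAt_linearForm] at hg
      exact hθ' _ ⟨W, hW, g, trivial, rfl⟩ y ⟨hy, hg⟩ fun j => h j.succ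

end FiniteGroup

/-! ### Upper bound for the pole orders -/

section OneSubXPow

theorem leadingCoeff_one_sub_X_pow {R : Type*} [CommRing R] [Nontrivial R] {d : ℕ} (hd : d ≠ 0) :
    (1 - X ^ d : R[X]).leadingCoeff = -1 := by
  rw [← neg_sub, leadingCoeff_neg, leadingCoeff_X_pow_sub_one (Nat.pos_of_ne_zero hd)]

theorem isUnit_leadingCoeff_prod_one_sub_X_pow {l : List ℕ} (hl : ∀ d ∈ l, d ≠ 0) :
    IsUnit (l.map fun d => (1 - X ^ d : ℤ[X])).prod.leadingCoeff := by
  induction l with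
  | nil => simp
  | cons d l ih =>
    rw [List.map_cons, List.prod_cons, leadingCoeff_mul,
      leadingCoeff_one_sub_X_pow (hl d (by simp))]
    exact isUnit_one.neg.mul (ih fun d hd => hl d (by simp [hd]))

variable {K : Type*} [Field K] [CharZero K]

theorem one_sub_X_pow_ne_zero {d : ℕ} (hd : d ≠ 0) : (1 - X ^ d : K[X]) ≠ 0 := by
  rw [← leadingCoeff_ne_zero, leadingCoeff_one_sub_X_pow hd]
  simp

theorem rootMultiplicity_one_sub_X_pow_le [DecidableEq K] (w : K) {d : ℕ} (hd : d ≠ 0) :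
    rootMultiplicity w (1 - X ^ d : K[X]) ≤ if w ^ d = 1 then 1 else 0 := by
  split_ifs with h
  · refine rootMultiplicity_le_one_of_separable ?_ w
    rw [← neg_sub, ← neg_one_mul]
    exact Separable.unit_mul isUnit_one.neg (X_pow_sub_one_separable_iff.2 (Nat.cast_ne_zero.2 hd))
  · rw [rootMultiplicity_eq_zero]
    simpa [sub_eq_zero] using Ne.symm h

theorem rootMultiplicity_prod_one_sub_X_pow_le [DecidableEq K] (w : K) {l : List ℕ}
    (hl : ∀ d ∈ l, d ≠ 0) :
    rootMultiplicity w (l.map fun d => (1 - X ^ d : K[X])).prod ≤ l.countP (w ^ · = 1) := by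
  induction l with
  | nil => simp
  | cons d l ih =>
    have hd := hl d (by simp)
    have hl' : ∀ d ∈ l, d ≠ 0 := fun d hd => hl d (by simp [hd])
    have hne : (l.map fun d => (1 - X ^ d : K[X])).prod ≠ 0 := by
      refine List.prod_ne_zero fun h => ?_
      obtain ⟨d, hd, h⟩ := List.mem_map.1 h
      exact one_sub_X_pow_ne_zero (hl' d hd) h
    rw [List.map_cons, List.prod_cons, rootMultiplicity_mul (mul_ne_zero
      (one_sub_X_pow_ne_zero hd) hne), List.countP_cons, add_comm]
    refine add_le_add (ih hl') ?_
    simpa using rootMultiplicity_one_sub_X_pow_le w hd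

end OneSubXPow

theorem exists_denominator {K G Y : Type*} [Field K] [IsAlgClosed K] [CharZero K]
    [Group G] [Finite G] [AddCommGroup Y] [Module K Y] [FiniteDimensional K Y]
    (ρ : Representation K G Y) (w : K) (m : ℕ)
    (hm : ∀ g, Module.finrank K (Module.End.eigenspace (ρ g) w) ≤ m) :
    ∃ D : ℤ[X], IsUnit D.leadingCoeff ∧
      rootMultiplicity w (D.map (Int.castRingHom K)) ≤ m ∧
      ∀ I : Ideal (invariantRing ρ), I.IsHomogeneous (invariantRingDegree ρ) →
        ∃ P : ℤ[X], (D : PowerSeries ℤ) * hilbertSeries (invariantRingDegree ρ) I =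
          (P : PowerSeries ℤ) := by
  classical
  set T : Set (invariantRing ρ) := {a | ∃ d, a ∈ invariantRingDegree ρ d ∧ w ^ d ≠ 1} with hT
  obtain ⟨s, hsT, hs⟩ := (Submodule.fg_span_iff_fg_span_finset_subset T).1
    (IsNoetherian.noetherian (Ideal.span T))
  have hdeg : ∀ a ∈ T, ∃ d, a ∈ invariantRingDegree ρ d ∧ w ^ d ≠ 1 := fun a h => h
  choose! deg hdeg hdeg' using hdeg
  obtain ⟨θ, hθ, hθ'⟩ := exists_invariants_separating ρ m
    (Set.range fun g => Module.End.eigenspace (ρ g) w) (Set.finite_range _) (by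
      rintro _ ⟨g, rfl⟩
      exact hm g)
  set L : List (invariantRing ρ × ℕ) :=
    (s.toList.map fun a => (a, deg a)) ++ List.ofFn fun j => (θ j, Nat.card G) with hL
  have hLmem : ∀ p ∈ L, p.1 ∈ invariantRingDegree ρ p.2 := by
    intro p hp
    rcases List.mem_append.1 hp with hp | hp
    · obtain ⟨a, ha, rfl⟩ := List.mem_map.1 hp
      exact hdeg a (hsT (by simpa using ha))
    · obtain ⟨j, rfl⟩ := (List.mem_ofFn' _ _).1 hp
      exact hθ j
  set I := Ideal.span {a | ∃ p ∈ L, p.1 = a} with hI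
  have hθI : ∀ j, θ j ∈ I := fun j => Ideal.subset_span
    ⟨(θ j, Nat.card G), List.mem_append_right _ ((List.mem_ofFn' _ _).2 ⟨j, rfl⟩), rfl⟩
  have hTI : ∀ a ∈ T, a ∈ I := fun a ha => by
    have h1 : a ∈ Submodule.span (invariantRing ρ) (s : Set (invariantRing ρ)) :=
      hs ▸ Submodule.subset_span ha
    refine Submodule.span_mono (fun b hb => ?_) h1
    exact ⟨(b, deg b), List.mem_append_left _ (List.mem_map.2 ⟨b, by simpa using hb, rfl⟩), rfl⟩
  -- The elements of `T` force a common zero into a `w`-eigenspace, where the `θ j` have no common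
  -- zero but the origin.
  obtain ⟨n, hn⟩ := exists_coordinateRingDegree_le
    (J := I.map (algebraMap (invariantRing ρ) (CoordinateRing K Y))) (by
      intro y hy
      have hy' : ∀ a ∈ I, evalAt y (a : CoordinateRing K Y) = 0 := fun a ha =>
        hy _ (Ideal.mem_map_of_mem (algebraMap (invariantRing ρ) (CoordinateRing K Y)) ha)
      obtain ⟨g, hg⟩ := exists_apply_eq_smul ρ (w := w) (y := y) fun d hd a ha =>
        hy' a (hTI a ⟨d, ha, hd⟩)
      exact hθ' _ ⟨g, rfl⟩ y (Module.End.mem_eigenspace_iff.2 hg) fun j => hy' _ (hθI j))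
  have hl0 : ∀ d ∈ L.map Prod.snd, d ≠ 0 := by
    intro d hd
    obtain ⟨p, hp, rfl⟩ := List.mem_map.1 hd
    rcases List.mem_append.1 hp with hp | hp
    · obtain ⟨a, ha, rfl⟩ := List.mem_map.1 hp
      -- Degree `0` cannot occur in `T`, since `w ^ 0 = 1`.
      intro h0
      apply hdeg' a (hsT (by simpa using ha))
      dsimp only at h0
      rw [h0, pow_zero]
    · obtain ⟨j, rfl⟩ := (List.mem_ofFn' _ _).1 hp
      exact Nat.card_pos.ne'
  refine ⟨((L.map Prod.snd).map fun d => (1 - X ^ d : ℤ[X])).prod,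
    isUnit_leadingCoeff_prod_one_sub_X_pow hl0, ?_, fun N hN => ?_⟩
  · have h1 : (((L.map Prod.snd).map fun d => (1 - X ^ d : ℤ[X])).prod).map (Int.castRingHom K) =
        ((L.map Prod.snd).map fun d => (1 - X ^ d : K[X])).prod := by
      rw [Polynomial.map_list_prod, List.map_map]
      congr 2
      funext d
      simp
    rw [h1]
    refine (rootMultiplicity_prod_one_sub_X_pow_le w hl0).trans ?_
    rw [hL, List.map_append, List.countP_append]
    -- The degrees chosen from `T` contribute no zero at `w`; only the `m` entries `Nat.card G` can.
    have h2 : List.countP (fun d => decide (w ^ d = 1))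
        ((s.toList.map fun a => (a, deg a)).map Prod.snd) = 0 := by
      rw [List.countP_eq_zero]
      intro d hd
      simp only [List.map_map, List.mem_map, Function.comp_apply] at hd
      obtain ⟨a, ha, rfl⟩ := hd
      simpa using hdeg' a (hsT (by simpa using ha))
    rw [h2, zero_add]
    refine List.countP_le_length.trans ?_
    simp
  · obtain ⟨P, hP⟩ := mem_polynomialSubring.1 (list_prod_mul_hilbertSeries_mem L hLmem
      (fun d hd c hc => mem_of_mem_map_invariantRing ρ I c (hn d hd c hc)) N hN)
    refine ⟨P, hP ▸ ?_⟩
    congr 1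
    rw [← Polynomial.coeToPowerSeries.ringHom_apply, map_list_prod, List.map_map, List.map_map]
    congr 2
    funext p
    simp

/-! ### Pole orders of integral power series -/

section PoleOrder

/-- The terms of the power series `F` at the real number `t` are absolutely summable. -/
def SummableAt (t : ℝ) (F : PowerSeries ℤ) : Prop :=
  Summable fun d => ‖((PowerSeries.coeff d F : ℤ) : ℝ) * t ^ d‖

/-- The value of the power series `F` at the real number `t`. -/
noncomputable def sumAt (t : ℝ) (F : PowerSeries ℤ) : ℝ :=
  ∑' d, ((PowerSeries.coeff d F : ℤ) : ℝ) * t ^ d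

variable {t : ℝ}

theorem coeff_mul_mul_pow (F F' : PowerSeries ℤ) (d : ℕ) :
    ((PowerSeries.coeff d (F * F') : ℤ) : ℝ) * t ^ d =
      ∑ p ∈ Finset.HasAntidiagonal.antidiagonal d,
        (((PowerSeries.coeff p.1 F : ℤ) : ℝ) * t ^ p.1) *
          (((PowerSeries.coeff p.2 F' : ℤ) : ℝ) * t ^ p.2) := by
  rw [PowerSeries.coeff_mul, Int.cast_sum, Finset.sum_mul]
  refine Finset.sum_congr rfl fun p hp => ?_
  rw [← Finset.HasAntidiagonal.mem_antidiagonal.1 hp, pow_add]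
  push_cast
  ring

theorem SummableAt.mul {F F' : PowerSeries ℤ} (h : SummableAt t F) (h' : SummableAt t F') :
    SummableAt t (F * F') := by
  have := summable_norm_sum_mul_antidiagonal_of_summable_norm h h'
  unfold SummableAt
  simpa only [coeff_mul_mul_pow] using this

theorem sumAt_mul {F F' : PowerSeries ℤ} (h : SummableAt t F) (h' : SummableAt t F') :
    sumAt t (F * F') = sumAt t F * sumAt t F' := by
  unfold sumAt
  rw [tsum_mul_tsum_eq_tsum_sum_antidiagonal_of_summable_norm h h']
  simp only [coeff_mul_mul_pow]

theorem summableAt_coe (P : ℤ[X]) : SummableAt t (P : PowerSeries ℤ) := by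
  refine summable_of_ne_finset_zero (s := P.support) fun d hd => ?_
  rw [Polynomial.coeff_coe, notMem_support_iff.1 hd]
  simp

theorem sumAt_coe (P : ℤ[X]) :
    sumAt t (P : PowerSeries ℤ) = (P.map (Int.castRingHom ℝ)).eval t := by
  unfold sumAt
  rw [tsum_eq_sum (s := P.support) fun d hd => by
    rw [Polynomial.coeff_coe, notMem_support_iff.1 hd]; simp]
  rw [eval_map, eval₂_eq_sum, Polynomial.sum]
  simp

theorem SummableAt.of_le {F F' : PowerSeries ℤ} (h : SummableAt t F)
    (h0 : ∀ d, 0 ≤ PowerSeries.coeff d F')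
    (hle : ∀ d, PowerSeries.coeff d F' ≤ PowerSeries.coeff d F) : SummableAt t F' := by
  refine Summable.of_nonneg_of_le (fun _ => norm_nonneg _) (fun d => ?_) h
  rw [norm_mul, norm_mul]
  refine mul_le_mul_of_nonneg_right ?_ (norm_nonneg _)
  rw [Real.norm_of_nonneg (Int.cast_nonneg (h0 d)),
    Real.norm_of_nonneg (Int.cast_nonneg ((h0 d).trans (hle d)))]
  exact_mod_cast hle d

theorem sumAt_le {F F' : PowerSeries ℤ} (ht : 0 ≤ t) (h : SummableAt t F) (h' : SummableAt t F')
    (hle : ∀ d, PowerSeries.coeff d F' ≤ PowerSeries.coeff d F) : sumAt t F' ≤ sumAt t F := by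
  refine Summable.tsum_le_tsum (fun d => ?_) h'.of_norm h.of_norm
  exact mul_le_mul_of_nonneg_right (by exact_mod_cast hle d) (pow_nonneg ht d)

theorem summableAt_one_pow (ht : 0 ≤ t) (ht1 : t < 1) (m : ℕ) :
    SummableAt t ((PowerSeries.mk 1 : PowerSeries ℤ) ^ m) := by
  induction m with
  | zero =>
    rw [pow_zero]
    simpa using summableAt_coe (t := t) 1
  | succ m ih =>
    rw [pow_succ]
    refine ih.mul ?_
    unfold SummableAt
    simpa [abs_of_nonneg ht] using summable_geometric_of_lt_one ht ht1

theorem sumAt_one_pow (ht : 0 ≤ t) (ht1 : t < 1) (m : ℕ) :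
    (1 - t) ^ m * sumAt t ((PowerSeries.mk 1 : PowerSeries ℤ) ^ m) = 1 := by
  have h : ((1 - X : ℤ[X]) : PowerSeries ℤ) ^ m * (PowerSeries.mk 1 : PowerSeries ℤ) ^ m = 1 := by
    rw [← mul_pow, mul_comm]
    simp [PowerSeries.mk_one_mul_one_sub_eq_one]
  have h1 := congrArg (sumAt t) h
  rw [← Polynomial.coe_pow, sumAt_mul (summableAt_coe _) (summableAt_one_pow ht ht1 m), sumAt_coe,
    ← Polynomial.coe_one, sumAt_coe] at h1
  simpa using h1

/-- If `F` has nonnegative coefficients and a multiple of `F` dominates `(1 - t) ^ (-m)`, then `F`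
has a pole of order at least `m` at `1`. -/
theorem add_rootMultiplicity_one_le {B P q : ℤ[X]} {F : PowerSeries ℤ} {m n : ℕ} (hB : B ≠ 0)
    (h : (B : PowerSeries ℤ) * F = P) (h0 : ∀ d, 0 ≤ PowerSeries.coeff d F)
    (hn : ∀ d, PowerSeries.coeff d F ≤ PowerSeries.coeff d (PowerSeries.mk 1 ^ n))
    (hm : ∀ d, PowerSeries.coeff d (PowerSeries.mk 1 ^ m) ≤
      PowerSeries.coeff d ((q : PowerSeries ℤ) * F)) :
    P ≠ 0 ∧ m + rootMultiplicity 1 P ≤ rootMultiplicity 1 B := by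
  -- The constant coefficient of `PowerSeries.mk 1 ^ m` is `1`, so the domination `hm` excludes `F =
  -- 0`.
  have hF : F ≠ 0 := by
    rintro rfl
    have := hm 0
    simp at this
  have hP : P ≠ 0 := by
    rintro rfl
    rw [Polynomial.coe_zero, mul_eq_zero, Polynomial.coe_eq_zero_iff] at h
    exact h.elim hB hF
  refine ⟨hP, ?_⟩
  have hinj : Function.Injective (Int.castRingHom ℝ) := Int.cast_injective
  rw [eq_rootMultiplicity_map hinj, eq_rootMultiplicity_map (p := B) hinj, map_one]
  have hB' : B.map (Int.castRingHom ℝ) ≠ 0 := (Polynomial.map_ne_zero_iff hinj).2 hB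
  have hP' : P.map (Int.castRingHom ℝ) ≠ 0 := (Polynomial.map_ne_zero_iff hinj).2 hP
  obtain ⟨B₁, hB₁, hB₁'⟩ := exists_eq_pow_rootMultiplicity_mul_and_not_dvd _ hB' 1
  obtain ⟨P₁, hP₁, -⟩ := exists_eq_pow_rootMultiplicity_mul_and_not_dvd _ hP' 1
  set b := rootMultiplicity 1 (B.map (Int.castRingHom ℝ))
  set p := rootMultiplicity 1 (P.map (Int.castRingHom ℝ))
  by_contra! hlt
  rw [dvd_iff_isRoot, IsRoot.def] at hB₁'
  set Q := q.map (Int.castRingHom ℝ)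
  -- Domination gives `1 ≤ (1 - t) ^ m * Q(t) * F(t)`, while `B * F = P` evaluates `F`; the bound
  -- `hn` guarantees convergence on the interval. If `b < m + p`, the right side tends to `0` as `t`
  -- tends to `1`, contradicting `B₁(1) ≠ 0`.
  have key : ∀ t ∈ Set.Ioo (0 : ℝ) 1,
      |B₁.eval t| ≤ (1 - t) ^ (m + p - b) * |Q.eval t * P₁.eval t| := by
    rintro t ⟨ht, ht1⟩
    have hs : SummableAt t F := (summableAt_one_pow ht.le ht1 n).of_le h0 hn
    have hpos : 0 < 1 - t := sub_pos.2 ht1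
    have e1 := congrArg (sumAt t) h
    rw [sumAt_mul (summableAt_coe _) hs, sumAt_coe, sumAt_coe, hB₁, hP₁] at e1
    have e2 := sumAt_le ht.le ((summableAt_coe q).mul hs) (summableAt_one_pow ht.le ht1 m) hm
    rw [sumAt_mul (summableAt_coe _) hs, sumAt_coe] at e2
    have e3 : 1 ≤ (1 - t) ^ m * (Q.eval t * sumAt t F) := by
      exact (sumAt_one_pow ht.le ht1 m).ge.trans
        (mul_le_mul_of_nonneg_left e2 (pow_nonneg hpos.le m))
    simp only [eval_mul, eval_pow, eval_sub, eval_X, eval_one, map_one] at e1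
    have e4 := congrArg abs e1
    have habs : |t - 1| = 1 - t := by rw [abs_sub_comm, abs_of_pos hpos]
    simp only [abs_mul, abs_pow, habs] at e4
    have e5 : |B₁.eval t| ≤ |B₁.eval t| * ((1 - t) ^ m * (|Q.eval t| * |sumAt t F|)) := by
      refine le_mul_of_one_le_right (abs_nonneg _) (e3.trans ?_)
      refine mul_le_mul_of_nonneg_left ?_ (pow_nonneg hpos.le m)
      rw [← abs_mul]
      exact le_abs_self _
    refine le_of_mul_le_mul_left ?_ (pow_pos hpos b)
    calc (1 - t) ^ b * |B₁.eval t|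
        ≤ (1 - t) ^ b * (|B₁.eval t| * ((1 - t) ^ m * (|Q.eval t| * |sumAt t F|))) :=
          mul_le_mul_of_nonneg_left e5 (pow_nonneg hpos.le b)
      _ = (1 - t) ^ m * |Q.eval t| * ((1 - t) ^ b * |B₁.eval t| * |sumAt t F|) := by ring
      _ = (1 - t) ^ m * |Q.eval t| * ((1 - t) ^ p * |P₁.eval t|) := by rw [e4]
      _ = (1 - t) ^ (m + p) * |Q.eval t * P₁.eval t| := by rw [abs_mul, pow_add]; ring
      _ = (1 - t) ^ b * ((1 - t) ^ (m + p - b) * |Q.eval t * P₁.eval t|) := by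
          rw [← mul_assoc, ← pow_add, Nat.add_sub_cancel' hlt.le]
  have hc1 : Continuous fun t => |B₁.eval t| := B₁.continuous.abs
  have hc2 : Continuous fun t => (1 - t) ^ (m + p - b) * |Q.eval t * P₁.eval t| :=
    ((continuous_const.sub continuous_id).pow _).mul (Q.continuous.mul P₁.continuous).abs
  have hlim := le_of_tendsto_of_tendsto (b := nhdsWithin (1 : ℝ) (Set.Iio 1))
    ((hc1.tendsto 1).mono_left nhdsWithin_le_nhds) ((hc2.tendsto 1).mono_left nhdsWithin_le_nhds)
    (Filter.eventually_of_mem (Ioo_mem_nhdsLT zero_lt_one) key)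
  rw [sub_self, zero_pow (by omega), zero_mul] at hlim
  exact hB₁' (abs_nonpos_iff.1 hlim)

/-- A power series supported in degrees `d` with `w ^ d = 1` has poles of the same order at `w`
and at `1`. -/
theorem rootMultiplicity_add_rootMultiplicity_one {K : Type*} [Field K] [CharZero K] {w : K}
    (hw : w ≠ 0) {B P : ℤ[X]} {F : PowerSeries ℤ} (hB : B ≠ 0) (hP : P ≠ 0)
    (h : (B : PowerSeries ℤ) * F = P) (hF : ∀ d, w ^ d ≠ 1 → PowerSeries.coeff d F = 0) :
    rootMultiplicity w (B.map (Int.castRingHom K)) + rootMultiplicity 1 P =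
      rootMultiplicity 1 B + rootMultiplicity w (P.map (Int.castRingHom K)) := by
  have hinj : Function.Injective (Int.castRingHom K) := Int.cast_injective
  set B' := B.map (Int.castRingHom K)
  set P' := P.map (Int.castRingHom K)
  have hB' : B' ≠ 0 := (Polynomial.map_ne_zero_iff hinj).2 hB
  have hP' : P' ≠ 0 := (Polynomial.map_ne_zero_iff hinj).2 hP
  set F' := PowerSeries.map (Int.castRingHom K) F
  have h' : (B' : PowerSeries K) * F' = P' := by
    have := congrArg (PowerSeries.map (Int.castRingHom K)) h
    rwa [map_mul, ← Polynomial.polynomial_map_coe, ← Polynomial.polynomial_map_coe] at this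
  have hF' : PowerSeries.rescale w F' = F' := by
    ext d
    rw [PowerSeries.coeff_rescale, PowerSeries.coeff_map]
    by_cases hd : w ^ d = 1
    · rw [hd, one_mul]
    · rw [hF d hd, map_zero, mul_zero]
  have hresc : ∀ p : K[X], PowerSeries.rescale w (p : PowerSeries K) =
      ((p.comp (C w * X + C 0) : K[X]) : PowerSeries K) := by
    intro p
    ext d
    rw [PowerSeries.coeff_rescale, Polynomial.coeff_coe, Polynomial.coeff_coe, map_zero, add_zero,
      comp_C_mul_X_coeff, mul_comm]
  have h'' := congrArg (PowerSeries.rescale w) h'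
  rw [map_mul, hF', hresc, hresc] at h''
  -- Both `B(t) F(t) = P(t)` and, by invariance of `F`, `B(w t) F(t) = P(w t)`; eliminate `F`. The
  -- order of `p(w t)` at `1` is that of `p` at `w`.
  have key : B'.comp (C w * X + C 0) * P' = B' * P'.comp (C w * X + C 0) := by
    apply Polynomial.coe_injective
    rw [Polynomial.coe_mul, Polynomial.coe_mul, ← h', ← h'']
    ring
  have hmul : ∀ p : K[X], rootMultiplicity 1 (p.comp (C w * X + C 0)) = rootMultiplicity w p := by
    intro p
    rw [rootMultiplicity_comp_C_mul_X_add_C _ _ _ _ (isUnit_iff_ne_zero.2 hw), mul_one, add_zero]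
  have hne : ∀ p : K[X], p ≠ 0 → p.comp (C w * X + C 0) ≠ 0 := by
    intro p hp h0
    have := hresc p
    rw [h0, Polynomial.coe_zero] at this
    apply hp
    ext d
    have hd := congrArg (PowerSeries.coeff d) this
    rw [PowerSeries.coeff_rescale, Polynomial.coeff_coe, map_zero] at hd
    exact (mul_eq_zero.1 hd).resolve_left (pow_ne_zero d hw)
  have := congrArg (rootMultiplicity 1) key
  rw [rootMultiplicity_mul (mul_ne_zero (hne _ hB') hP'),
    rootMultiplicity_mul (mul_ne_zero hB' (hne _ hP')), hmul, hmul] at this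
  rw [eq_rootMultiplicity_map (p := P) hinj, eq_rootMultiplicity_map (p := B) hinj, map_one]
  exact this

end PoleOrder

/-! ### Counting monomials and restricting to a subspace -/

section Monomials

theorem coeff_mk_one_pow (m d : ℕ) :
    PowerSeries.coeff d ((PowerSeries.mk 1 : PowerSeries ℤ) ^ m) =
      ((Finset.univ : Finset (Fin m)).finsuppAntidiag d).card := by
  have h : (PowerSeries.mk 1 : PowerSeries ℤ) ^ m =
      ∏ _i : Fin m, (PowerSeries.mk 1 : PowerSeries ℤ) := by simp
  rw [h, PowerSeries.coeff_prod]
  simp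

variable {K Y : Type*} [Field K] [AddCommGroup Y] [Module K Y]

theorem finrank_homogeneousSubmodule_le {n : ℕ} {d : ℕ}
    (W : Submodule K (MvPolynomial (Fin n) K))
    (hW : W ≤ MvPolynomial.homogeneousSubmodule (Fin n) K d) :
    Module.finrank K W ≤ ((Finset.univ : Finset (Fin n)).finsuppAntidiag d).card := by
  classical
  set T := ((Finset.univ : Finset (Fin n)).finsuppAntidiag d).image
    fun a => MvPolynomial.monomial a (1 : K)
  have hle : W ≤ Submodule.span K (T : Set (MvPolynomial (Fin n) K)) := by
    intro p hp
    rw [← MvPolynomial.support_sum_monomial_coeff p]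
    refine sum_mem fun a ha => ?_
    rw [← mul_one (MvPolynomial.coeff a p), ← smul_eq_mul, ← MvPolynomial.smul_monomial]
    refine Submodule.smul_mem _ _ (Submodule.subset_span (Finset.mem_coe.2
      (Finset.mem_image_of_mem _ ?_)))
    rw [Finset.mem_finsuppAntidiag]
    refine ⟨?_, Finset.subset_univ _⟩
    have h1 : a.degree = d := by
      rw [Finsupp.degree_eq_weight_one]
      exact (MvPolynomial.mem_homogeneousSubmodule d p).1 (hW hp) (MvPolynomial.mem_support_iff.1 ha)
    rw [← h1, Finsupp.degree_eq_sum]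
  have : FiniteDimensional K (Submodule.span K (T : Set (MvPolynomial (Fin n) K))) :=
    FiniteDimensional.span_finset K T
  exact (Submodule.finrank_mono hle).trans ((finrank_span_finset_le_card T).trans
    Finset.card_image_le)

theorem coordinateRingEquiv_mem_homogeneousSubmodule {ι : Type*} [Fintype ι] [DecidableEq ι]
    (b : Module.Basis ι K Y) {d : ℕ} {f : CoordinateRing K Y}
    (hf : f ∈ coordinateRingDegree K Y d) :
    coordinateRingEquiv b f ∈ MvPolynomial.homogeneousSubmodule ι K d := by
  unfold coordinateRingDegree at hf
  induction hf using Submodule.pow_induction_on_left' with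
  | algebraMap r =>
    rw [AlgEquiv.commutes]
    exact MvPolynomial.isHomogeneous_C _ r
  | add f f' i _ _ h h' =>
    rw [map_add]
    exact add_mem h h'
  | mem_mul m hm i f _ h =>
    obtain ⟨m, rfl⟩ := hm
    rw [map_mul, Nat.succ_eq_add_one, add_comm]
    refine MvPolynomial.IsHomogeneous.mul ?_ h
    rw [← b.dualBasis.sum_repr m, map_sum, map_sum, ← MvPolynomial.mem_homogeneousSubmodule]
    refine sum_mem fun i _ => ?_
    rw [map_smul, map_smul, ← coordinateRingEquiv_symm_X, AlgEquiv.apply_symm_apply]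
    exact Submodule.smul_mem _ _ (MvPolynomial.isHomogeneous_X K i)

theorem finrank_coordinateRingDegree_le [FiniteDimensional K Y] (d : ℕ) :
    (Module.finrank K (coordinateRingDegree K Y d) : ℤ) ≤
      PowerSeries.coeff d ((PowerSeries.mk 1 : PowerSeries ℤ) ^ Module.finrank K Y) := by
  rw [coeff_mk_one_pow]
  set e := coordinateRingEquiv (Module.finBasis K Y)
  have h1 := finrank_homogeneousSubmodule_le ((coordinateRingDegree K Y d).map e.toLinearMap) (by
    rintro _ ⟨f, hf, rfl⟩
    exact coordinateRingEquiv_mem_homogeneousSubmodule _ hf)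
  rw [← (Submodule.equivMapOfInjective e.toLinearMap e.injective _).finrank_eq] at h1
  exact_mod_cast h1

/-- Restriction of polynomial functions to a subspace. -/
noncomputable def restrictTo (V : Submodule K Y) : CoordinateRing K Y →ₐ[K] (V → K) :=
  AlgHom.pi fun v => evalAt (v : Y)

@[simp]
theorem restrictTo_apply (V : Submodule K Y) (f : CoordinateRing K Y) (v : V) :
    restrictTo V f v = evalAt (v : Y) f := rfl

theorem aeval_monomial_mem_coordinateRingDegree {n : ℕ} (x : Fin n → Module.Dual K Y) {d : ℕ}
    {a : Fin n →₀ ℕ} (ha : ∑ i, a i = d) :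
    MvPolynomial.aeval (fun i => linearForm K Y (x i)) (MvPolynomial.monomial a (1 : K)) ∈
      coordinateRingDegree K Y d := by
  rw [MvPolynomial.aeval_monomial, map_one, one_mul, Finsupp.prod_fintype _ _ (by simp)]
  have h := SetLike.prod_pow_mem_graded (coordinateRingDegree K Y) (F := Finset.univ)
    (fun _ => 1) (fun i => linearForm K Y (x i)) a (fun i _ => by simp [coordinateRingDegree])
  simpa [ha] using h

/-- Coordinates on `V` extend to linear forms on `Y`. Their degree `d` monomials stay independent as
functions on `V`, because over an infinite field a polynomial vanishing everywhere is zero. -/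
theorem le_finrank_map_restrictTo [CharZero K] [FiniteDimensional K Y] (V : Submodule K Y)
    (d : ℕ) :
    PowerSeries.coeff d ((PowerSeries.mk 1 : PowerSeries ℤ) ^ Module.finrank K V) ≤
      Module.finrank K ((coordinateRingDegree K Y d).map (restrictTo V).toLinearMap) := by
  rw [coeff_mk_one_pow]
  set b := Module.finBasis K V
  have hx : ∀ i, ∃ x : Module.Dual K Y, x ∘ₗ V.subtype = b.dualBasis i := fun i =>
    LinearMap.exists_extend (b.dualBasis i)
  choose x hx using hx
  set ψ : MvPolynomial (Fin (Module.finrank K V)) K →ₐ[K] (V → K) :=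
    (restrictTo V).comp (MvPolynomial.aeval fun i => linearForm K Y (x i))
  have hψ : ∀ p v, ψ p v = MvPolynomial.eval (b.repr v) p := by
    intro p v
    have : (Pi.evalAlgHom K (fun _ : V => K) v).comp ψ = MvPolynomial.aeval (b.repr v) := by
      refine MvPolynomial.algHom_ext fun i => ?_
      have h1 := LinearMap.congr_fun (hx i) v
      simp only [LinearMap.comp_apply, Submodule.subtype_apply,
        Module.Basis.dualBasis_apply] at h1
      simp [ψ, h1]
    have h2 := DFunLike.congr_fun this p
    rw [← MvPolynomial.coe_aeval_eq_eval]
    exact h2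
  have hinj : Function.Injective ψ := by
    rw [injective_iff_map_eq_zero]
    intro p hp
    refine MvPolynomial.funext fun y => ?_
    have h1 := congrFun hp (b.equivFun.symm y)
    rw [hψ, ← b.equivFun_apply, LinearEquiv.apply_symm_apply] at h1
    rw [h1, map_zero]
    rfl
  set T := (Finset.univ : Finset (Fin (Module.finrank K V))).finsuppAntidiag d
  have hli : LinearIndependent K fun a : T => ψ (MvPolynomial.monomial (a : _ →₀ ℕ) (1 : K)) := by
    have h1 := (MvPolynomial.basisMonomials (Fin (Module.finrank K V)) K).linearIndependent.map'
      ψ.toLinearMap (LinearMap.ker_eq_bot.2 hinj)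
    have h2 := h1.comp (fun a : T => (a : _ →₀ ℕ)) Subtype.val_injective
    simpa [Function.comp_def] using h2
  have hmem : ∀ a : T, ψ (MvPolynomial.monomial (a : _ →₀ ℕ) (1 : K)) ∈
      (coordinateRingDegree K Y d).map (restrictTo V).toLinearMap := by
    intro a
    exact Submodule.mem_map_of_mem
      (aeval_monomial_mem_coordinateRingDegree x (Finset.mem_finsuppAntidiag.1 a.2).1)
  have hli' : LinearIndependent K fun a : T => (⟨_, hmem a⟩ :
      (coordinateRingDegree K Y d).map (restrictTo V).toLinearMap) :=
    LinearIndependent.of_comp (Submodule.subtype _) hli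
  have h4 := hli'.fintype_card_le_finrank
  rw [Fintype.card_coe] at h4
  exact_mod_cast h4

end Monomials

section FinrankLemmas

variable {K A : Type*} [Field K] [CommRing A] [Algebra K A]

theorem Submodule.finrank_mul_le_mul_finrank (M N : Submodule K A) [FiniteDimensional K M]
    [FiniteDimensional K N] :
    Module.finrank K ↥(M * N) ≤ Module.finrank K M * Module.finrank K N := by
  rw [← Submodule.mulMap_range, ← Module.finrank_tensorProduct]
  exact LinearMap.finrank_range_le _

theorem Submodule.finrank_finset_sup_le {V ι : Type*} [AddCommGroup V] [Module K V]
    (s : Finset ι) (W : ι → Submodule K V) (hW : ∀ i ∈ s, FiniteDimensional K (W i)) :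
    FiniteDimensional K ↥(s.sup W) ∧
      Module.finrank K ↥(s.sup W) ≤ ∑ i ∈ s, Module.finrank K (W i) := by
  classical
  induction s using Finset.induction_on with
  | empty =>
    rw [Finset.sup_empty]
    exact ⟨inferInstance, by simp⟩
  | insert i s hi ih =>
    obtain ⟨h1, h2⟩ := ih fun j hj => hW j (Finset.mem_insert_of_mem hj)
    have h3 := hW i (Finset.mem_insert_self i s)
    rw [Finset.sup_insert, Finset.sum_insert hi]
    exact ⟨inferInstance, (Submodule.finrank_add_le_finrank_add_finrank _ _).trans (by omega)⟩

end FinrankLemmas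

/-! ### Lower bound for the pole orders -/

section LowerBound

variable {K G Y : Type*} [Field K] [Group G] [AddCommGroup Y] [Module K Y]
  (ρ : Representation K G Y)

/-- The invariant forms of degree `d`, as a subspace of the coordinate ring. -/
noncomputable def invariantForms (d : ℕ) : Submodule K (CoordinateRing K Y) :=
  (invariantRingDegree ρ d).map (invariantRing ρ).val.toLinearMap

theorem mem_invariantForms {d : ℕ} {f : CoordinateRing K Y} :
    f ∈ invariantForms ρ d ↔ f ∈ invariantRing ρ ∧ f ∈ coordinateRingDegree K Y d := by
  constructor
  · rintro ⟨a, ha, rfl⟩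
    exact ⟨a.2, ha⟩
  · rintro ⟨h, h'⟩
    exact ⟨⟨f, h⟩, h', rfl⟩

instance invariantForms_finiteDimensional [FiniteDimensional K Y] (d : ℕ) :
    FiniteDimensional K (invariantForms ρ d) :=
  Submodule.finiteDimensional_of_le (S₂ := coordinateRingDegree K Y d) fun _ hf =>
    ((mem_invariantForms ρ).1 hf).2

/-- The span of the products of a form of degree less than `n` and an invariant form, of total
degree `d`. -/
noncomputable def lowDegreeProducts (n d : ℕ) : Submodule K (CoordinateRing K Y) :=
  ((Finset.HasAntidiagonal.antidiagonal d).filter fun p : ℕ × ℕ => p.1 < n).sup fun p =>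
    coordinateRingDegree K Y p.1 * invariantForms ρ p.2

theorem mul_mem_lowDegreeProducts {n d i j : ℕ} (hij : i + j = d) (hi : i < n)
    {f a : CoordinateRing K Y} (hf : f ∈ coordinateRingDegree K Y i)
    (ha : a ∈ invariantForms ρ j) : f * a ∈ lowDegreeProducts ρ n d := by
  have h := Finset.le_sup (f := fun p : ℕ × ℕ =>
    coordinateRingDegree K Y p.1 * invariantForms ρ p.2)
    (s := (Finset.HasAntidiagonal.antidiagonal d).filter fun p : ℕ × ℕ => p.1 < n)
    (b := (i, j)) (by simp [hij, hi])
  exact h (Submodule.mul_mem_mul hf ha)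

theorem lowDegreeProducts_mul_mem {n d j : ℕ} {f a : CoordinateRing K Y}
    (hf : f ∈ lowDegreeProducts ρ n d) (ha : a ∈ invariantForms ρ j) :
    f * a ∈ lowDegreeProducts ρ n (d + j) := by
  have : lowDegreeProducts ρ n d ≤
      (lowDegreeProducts ρ n (d + j)).comap (LinearMap.mulRight K a) := by
    refine Finset.sup_le fun p hp => Submodule.mul_le.2 fun x hx y hy => ?_
    rw [Finset.mem_filter, Finset.HasAntidiagonal.mem_antidiagonal] at hp
    rw [Submodule.mem_comap, LinearMap.mulRight_apply, mul_assoc]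
    refine mul_mem_lowDegreeProducts ρ (j := p.2 + j) (by omega) hp.2 hx ?_
    rw [mem_invariantForms] at hy ha ⊢
    exact ⟨mul_mem hy.1 ha.1, SetLike.GradedMul.mul_mem hy.2 ha.2⟩
  exact this hf

/-- The ideal of the invariants that vanish on a subspace. -/
noncomputable def vanishingInvariants (V : Submodule K Y) : Ideal (invariantRing ρ) :=
  RingHom.ker ((restrictTo V).comp (invariantRing ρ).val)

theorem mem_vanishingInvariants {V : Submodule K Y} {f : invariantRing ρ} :
    f ∈ vanishingInvariants ρ V ↔ ∀ v ∈ V, evalAt v (f : CoordinateRing K Y) = 0 := by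
  rw [vanishingInvariants, RingHom.mem_ker, funext_iff, Subtype.forall]
  rfl

/-- Since `V` is stable under scaling, `f (r • v)` is a polynomial in `r` that is identically zero;
its coefficients are the values at `v` of the components of `f`. -/
theorem vanishingInvariants_isHomogeneous [CharZero K] (V : Submodule K Y) :
    (vanishingInvariants ρ V).IsHomogeneous (invariantRingDegree ρ) := by
  classical
  intro i f hf
  rw [mem_vanishingInvariants] at hf ⊢
  intro v hv
  have h1 : ((DirectSum.decompose (invariantRingDegree ρ) f i : invariantRing ρ) :
      CoordinateRing K Y) =
        DirectSum.decompose (coordinateRingDegree K Y) (f : CoordinateRing K Y) i :=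
    invariantRingDecompose_apply ρ f i
  rw [h1]
  set c : ℕ → K := fun d => evalAt v
    (DirectSum.decompose (coordinateRingDegree K Y) (f : CoordinateRing K Y) d : CoordinateRing K Y)
  set s := (DirectSum.decompose (coordinateRingDegree K Y) (f : CoordinateRing K Y)).support
  have h2 : ∑ d ∈ s, C (c d) * X ^ d = 0 := by
    refine Polynomial.funext fun r => ?_
    rw [eval_zero, ← hf (r • v) (V.smul_mem r hv)]
    conv_rhs => rw [← DirectSum.sum_support_decompose (coordinateRingDegree K Y)
      (f : CoordinateRing K Y)]
    rw [map_sum, eval_finsetSum]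
    refine Finset.sum_congr rfl fun d _ => ?_
    rw [evalAt_smul r v (SetLike.coe_mem _)]
    rw [eval_C_mul, eval_pow, eval_X, mul_comm]
  have h3 := congrArg (fun p => coeff p i) h2
  simp only [finsetSum_coeff, coeff_C_mul_X_pow, coeff_zero, Finset.sum_ite_eq] at h3
  by_cases hi : i ∈ s
  · simpa [hi] using h3
  · rw [DFinsupp.notMem_support_iff.1 hi]
    simp

variable [FiniteDimensional K Y]

theorem coeff_hilbertSeries_sub_vanishingInvariants (V : Submodule K Y) (d : ℕ) :
    PowerSeries.coeff d (hilbertSeries (invariantRingDegree ρ) ⊤ -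
        hilbertSeries (invariantRingDegree ρ) (vanishingInvariants ρ V)) =
      Module.finrank K ((invariantForms ρ d).map (restrictTo V).toLinearMap) := by
  have h := Submodule.finrank_map_add_finrank_inf_ker (invariantRingDegree ρ d)
    ((restrictTo V).comp (invariantRing ρ).val).toLinearMap
  have h1 : (invariantRingDegree ρ d).map ((restrictTo V).comp (invariantRing ρ).val).toLinearMap =
      (invariantForms ρ d).map (restrictTo V).toLinearMap := by
    rw [invariantForms, ← Submodule.map_comp]
    rfl
  have h2 : invariantRingDegree ρ d ⊓
      LinearMap.ker ((restrictTo V).comp (invariantRing ρ).val).toLinearMap =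
      (vanishingInvariants ρ V).restrictScalars K ⊓ invariantRingDegree ρ d := by
    rw [inf_comm]
    rfl
  have h3 : (⊤ : Ideal (invariantRing ρ)).restrictScalars K ⊓ invariantRingDegree ρ d =
      invariantRingDegree ρ d := by simp
  rw [h1, h2] at h
  rw [map_sub, hilbertSeries, hilbertSeries, PowerSeries.coeff_mk, PowerSeries.coeff_mk, h3, ← h]
  push_cast
  ring

variable [CharZero K] [Finite G]

/-- Graded Nakayama: invariants of positive degree vanish together only at `0`, so forms of degree
at least `n` lie in the ideal they generate. Splitting off an invariant factor lowers the degree of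
the cofactor, and induction finishes. -/
theorem exists_coordinateRingDegree_le_lowDegreeProducts [IsAlgClosed K] :
    ∃ n, ∀ d, coordinateRingDegree K Y d ≤ lowDegreeProducts ρ n d := by
  set T : Set (CoordinateRing K Y) := {a | ∃ j, j ≠ 0 ∧ a ∈ invariantForms ρ j}
  obtain ⟨n, hn⟩ := exists_coordinateRingDegree_le (J := Ideal.span T) (by
    intro y hy
    -- With `w = 0` the condition `w ^ d ≠ 1` means `d ≠ 0`, and a vector killed by the invertible
    -- `ρ g` is zero.
    obtain ⟨g, hg⟩ := exists_apply_eq_smul ρ (w := 0) (y := y) (by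
      intro d hd a ha
      refine hy _ (Ideal.subset_span ⟨d, ?_, ⟨a, ha, rfl⟩⟩)
      rintro rfl
      exact hd (pow_zero 0))
    have := congrArg (ρ g⁻¹) hg
    simpa using this)
  refine ⟨n, fun d => ?_⟩
  induction d using Nat.strong_induction_on with
  | _ d ih =>
    intro f hf
    by_cases hd : d < n
    · rw [← mul_one f]
      refine mul_mem_lowDegreeProducts ρ (add_zero d) hd hf ?_
      rw [mem_invariantForms]
      exact ⟨one_mem _, SetLike.GradedOne.one_mem⟩
    · have key : ∀ x ∈ Ideal.span T, ∀ c : CoordinateRing K Y,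
          (DirectSum.decompose (coordinateRingDegree K Y) (c * x) d : CoordinateRing K Y) ∈
            lowDegreeProducts ρ n d := by
        intro x hx
        induction hx using Submodule.span_induction with
        | mem a ha =>
          intro c
          obtain ⟨j, hj, ha⟩ := ha
          have ha' := ((mem_invariantForms ρ).1 ha).2
          by_cases hjd : j ≤ d
          · rw [mul_comm, DirectSum.coe_decompose_mul_of_left_mem_of_le _ ha' hjd, mul_comm]
            have h1 := ih (d - j) (by omega) (SetLike.coe_mem
              (DirectSum.decompose (coordinateRingDegree K Y) c (d - j)))
            have h2 := lowDegreeProducts_mul_mem ρ h1 ha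
            rwa [Nat.sub_add_cancel hjd] at h2
          · rw [mul_comm, DirectSum.coe_decompose_mul_of_left_mem_of_not_le _ ha' hjd]
            exact zero_mem _
        | zero => simp
        | add x y _ _ h h' =>
          intro c
          rw [mul_add, DirectSum.decompose_add, DirectSum.add_apply, Submodule.coe_add]
          exact add_mem (h c) (h' c)
        | smul r x _ h =>
          intro c
          rw [smul_eq_mul, ← mul_assoc]
          exact h _
      have h1 := key f (hn d (not_lt.1 hd) f hf) 1
      rwa [one_mul, DirectSum.decompose_of_mem_same _ hf] at h1

theorem finrank_eigenspace_le_rootMultiplicity [IsAlgClosed K] (g : G) (w : K) {B : ℤ[X]}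
    (hB : IsCommonDenominator (invariantRingDegree ρ) B) :
    Module.finrank K (Module.End.eigenspace (ρ g) w) ≤
      rootMultiplicity w (B.map (Int.castRingHom K)) := by
  set V := Module.End.eigenspace (ρ g) w with hV
  have hinv : ∀ v : Y, ρ g⁻¹ (ρ g v) = v := fun v => by simp
  -- Comparing poles at `w` and `1` needs `w ≠ 0`; for `w = 0` the eigenspace is trivial.
  by_cases hw : w = 0
  · have : V = ⊥ := by
      rw [eq_bot_iff]
      intro v hv
      rw [hV, Module.End.mem_eigenspace_iff, hw, zero_smul] at hv
      rw [Submodule.mem_bot, ← hinv v, hv, map_zero]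
    rw [this, finrank_bot]
    exact Nat.zero_le _
  have hB0 : B ≠ 0 := by
    rintro rfl
    exact zero_ne_one hB.1
  obtain ⟨P₁, hP₁⟩ := hB.2 ⊤ (Ideal.IsHomogeneous.top _)
  obtain ⟨P₂, hP₂⟩ := hB.2 (vanishingInvariants ρ V) (vanishingInvariants_isHomogeneous ρ V)
  set F := hilbertSeries (invariantRingDegree ρ) ⊤ -
    hilbertSeries (invariantRingDegree ρ) (vanishingInvariants ρ V)
  have hF : (B : PowerSeries ℤ) * F = ((P₁ - P₂ : ℤ[X]) : PowerSeries ℤ) := by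
    rw [mul_sub, hP₁, hP₂, Polynomial.coe_sub]
  have hcoeff : ∀ d, PowerSeries.coeff d F =
      Module.finrank K ((invariantForms ρ d).map (restrictTo V).toLinearMap) :=
    coeff_hilbertSeries_sub_vanishingInvariants ρ V
  obtain ⟨n, hn⟩ := exists_coordinateRingDegree_le_lowDegreeProducts ρ
  obtain ⟨hP0, hle⟩ := add_rootMultiplicity_one_le (m := Module.finrank K V)
    (n := Module.finrank K Y)
    -- The Hilbert polynomial of the forms of degree below `n`. On `V`, every form is a sum of
    -- products of such forms with invariants, so `q * F` bounds the dimensions of the restricted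
    -- forms.
    (q := ∑ i ∈ Finset.range n, C (Module.finrank K (coordinateRingDegree K Y i) : ℤ) * X ^ i)
    hB0 hF (fun d => by rw [hcoeff]; positivity)
    (fun d => by
      refine le_trans ?_ (finrank_coordinateRingDegree_le d)
      rw [hcoeff]
      refine Int.ofNat_le.2 ((Submodule.finrank_map_le _ _).trans (Submodule.finrank_mono ?_))
      exact fun f hf => ((mem_invariantForms ρ).1 hf).2)
    (fun d => by
      refine (le_finrank_map_restrictTo V d).trans ?_
      set W : ℕ × ℕ → Submodule K (V → K) := fun p =>
        (coordinateRingDegree K Y p.1).map (restrictTo V).toLinearMap *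
          (invariantForms ρ p.2).map (restrictTo V).toLinearMap
      set s := (Finset.HasAntidiagonal.antidiagonal d).filter fun p : ℕ × ℕ => p.1 < n
      have h1 : (coordinateRingDegree K Y d).map (restrictTo V).toLinearMap ≤ s.sup W := by
        refine Submodule.map_le_iff_le_comap.2 ((hn d).trans (Finset.sup_le fun p hp => ?_))
        rw [← Submodule.map_le_iff_le_comap, Submodule.map_mul]
        exact Finset.le_sup (f := W) hp
      obtain ⟨h2, h3⟩ := Submodule.finrank_finset_sup_le s W fun p _ =>
        Module.Finite.iff_fg.2 ((Module.Finite.iff_fg.1 inferInstance).mul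
          (Module.Finite.iff_fg.1 inferInstance))
      have h4 := (Submodule.finrank_mono h1).trans h3
      rw [PowerSeries.coeff_mul]
      have h5 : ∀ p ∈ s, (Module.finrank K (W p) : ℤ) ≤
          Module.finrank K (coordinateRingDegree K Y p.1) * PowerSeries.coeff p.2 F := by
        intro p _
        rw [hcoeff]
        exact_mod_cast (Submodule.finrank_mul_le_mul_finrank _ _).trans
          (Nat.mul_le_mul_right _ (Submodule.finrank_map_le _ _))
      have h6 : (Module.finrank K ((coordinateRingDegree K Y d).map (restrictTo V).toLinearMap) : ℤ)
          ≤ ∑ p ∈ s, (Module.finrank K (W p) : ℤ) := by exact_mod_cast h4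
      refine h6.trans ((Finset.sum_le_sum h5).trans (le_of_eq ?_))
      rw [Finset.sum_filter]
      refine Finset.sum_congr rfl fun p _ => ?_
      rw [Polynomial.coeff_coe, finsetSum_coeff]
      simp only [coeff_C_mul_X_pow, Finset.sum_ite_eq, Finset.mem_range]
      split_ifs <;> simp)
  -- For `v` in `V` an invariant form of degree `d` satisfies `f v = f (ρ g v) = w ^ d * f v`.
  have hdeg : ∀ d, w ^ d ≠ 1 → PowerSeries.coeff d F = 0 := by
    intro d hd
    have : (invariantForms ρ d).map (restrictTo V).toLinearMap = ⊥ := by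
      rw [eq_bot_iff]
      rintro _ ⟨f, hf, rfl⟩
      obtain ⟨hf1, hf2⟩ := (mem_invariantForms ρ).1 hf
      rw [Submodule.mem_bot]
      funext v
      have h1 := evalAt_apply_of_mem_invariantRing hf1 g (v : Y)
      rw [Module.End.mem_eigenspace_iff.1 v.2, evalAt_smul w _ hf2] at h1
      have h2 : (w ^ d - 1) * evalAt (v : Y) f = 0 := by rw [sub_mul, h1, one_mul, sub_self]
      exact (mul_eq_zero.1 h2).resolve_left (sub_ne_zero.2 hd)
    rw [hcoeff, this, finrank_bot, Nat.cast_zero]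
  have := rootMultiplicity_add_rootMultiplicity_one hw hB0 hP0 hF hdeg
  omega

end LowerBound

/-! ### Divisibility and root multiplicities over the integers -/

section Divisibility

variable {K : Type*} [Field K]

theorem dvd_of_rootMultiplicity_le [IsAlgClosed K] {p q : K[X]} (hp : p ≠ 0)
    (h : q ≠ 0 → ∀ w, rootMultiplicity w p ≤ rootMultiplicity w q) : p ∣ q := by
  classical
  by_cases hq : q = 0
  · exact hq ▸ dvd_zero p
  · rw [IsAlgClosed.dvd_iff_roots_le_roots hp hq, Multiset.le_iff_count]
    intro w
    rw [count_roots, count_roots]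
    exact h hq w

/-- A leading coefficient `1` or `-1` makes `p` monic up to sign, and divisibility by a monic
polynomial descends along an injective ring map. -/
theorem dvd_of_map_dvd_map [CharZero K] {p q : ℤ[X]} (hp : IsUnit p.leadingCoeff)
    (h : p.map (Int.castRingHom K) ∣ q.map (Int.castRingHom K)) : p ∣ q := by
  have hu : p.leadingCoeff * p.leadingCoeff = 1 := Int.isUnit_mul_self hp
  have hmonic : (C p.leadingCoeff * p).Monic := monic_C_mul_of_mul_leadingCoeff_eq_one hu
  have hdvd : p ∣ C p.leadingCoeff * p := dvd_mul_left _ _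
  refine hdvd.trans ((map_dvd_map (Int.castRingHom K) Int.cast_injective hmonic).1 ?_)
  rw [Polynomial.map_mul, map_C]
  exact (IsUnit.mul_left_dvd (isUnit_C.2 (hp.map (Int.castRingHom K)))).2 h

theorem dvd_of_rootMultiplicity_map_le [IsAlgClosed K] [CharZero K] {p q : ℤ[X]}
    (hp : IsUnit p.leadingCoeff)
    (h : q ≠ 0 → ∀ w : K, rootMultiplicity w (p.map (Int.castRingHom K)) ≤
      rootMultiplicity w (q.map (Int.castRingHom K))) : p ∣ q := by
  have hinj : Function.Injective (Int.castRingHom K) := Int.cast_injective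
  refine dvd_of_map_dvd_map (K := K) hp (dvd_of_rootMultiplicity_le ?_ fun hq =>
    h ((Polynomial.map_ne_zero_iff hinj).1 hq))
  rw [Polynomial.map_ne_zero_iff hinj, ← leadingCoeff_ne_zero]
  exact hp.ne_zero

theorem isUnit_cyclotomic_coeff_zero (k : ℕ) : IsUnit ((cyclotomic k ℤ).eval 0) := by
  rcases Nat.lt_trichotomy k 1 with hk | rfl | hk
  · rw [Nat.lt_one_iff.1 hk]
    simp
  · simp
  · rw [← coeff_zero_eq_eval_zero, cyclotomic_coeff_zero ℤ hk]
    exact isUnit_one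

/-- A multiplicity function on roots of unity that depends only on the order is that of an
integral polynomial. -/
theorem exists_int_polynomial_rootMultiplicity [CharZero K] (M : K → ℕ) {n : ℕ} (hn : n ≠ 0)
    (h0 : ∀ w, w ^ n ≠ 1 → M w = 0)
    (hM : ∀ k w w', k ≠ 0 → IsPrimitiveRoot w k → IsPrimitiveRoot w' k → M w = M w') :
    ∃ B : ℤ[X], IsUnit B.leadingCoeff ∧ B.coeff 0 = 1 ∧
      ∀ w, rootMultiplicity w (B.map (Int.castRingHom K)) = M w := by
  classical
  set m : ℕ → ℕ := fun k => if h : ∃ w : K, IsPrimitiveRoot w k then M h.choose else 0 with hm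
  have hm' : ∀ k w, k ≠ 0 → IsPrimitiveRoot w k → m k = M w := by
    intro k w hk hw
    have h : ∃ w : K, IsPrimitiveRoot w k := ⟨w, hw⟩
    simp only [hm, dif_pos h]
    exact hM k _ _ hk h.choose_spec hw
  set B₀ : ℤ[X] := ∏ k ∈ n.divisors, cyclotomic k ℤ ^ m k with hB₀
  have hmonic : B₀.Monic := monic_prod_of_monic _ _ fun k _ => (cyclotomic.monic k ℤ).pow _
  have hc : IsUnit (B₀.coeff 0) := by
    rw [coeff_zero_eq_eval_zero, hB₀, eval_prod]
    refine Finset.prod_induction _ IsUnit (fun _ _ => IsUnit.mul) isUnit_one fun k _ => ?_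
    rw [eval_pow]
    exact (isUnit_cyclotomic_coeff_zero k).pow _
  -- Cyclotomic polynomials have constant term `1` or `-1`, so multiplying by `B₀.coeff 0` makes the
  -- constant term `1`.
  refine ⟨C (B₀.coeff 0) * B₀, ?_, ?_, fun w => ?_⟩
  · rw [leadingCoeff_mul, leadingCoeff_C, hmonic.leadingCoeff, mul_one]
    exact hc
  · rw [coeff_C_mul, Int.isUnit_mul_self hc]
  · have hmap : B₀.map (Int.castRingHom K) = ∏ k ∈ n.divisors, cyclotomic k K ^ m k := by
      rw [hB₀, Polynomial.map_prod]
      simp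
    have hne : (∏ k ∈ n.divisors, cyclotomic k K ^ m k) ≠ 0 :=
      Finset.prod_ne_zero_iff.2 fun k _ => pow_ne_zero _ (cyclotomic_ne_zero k K)
    have hc' : Int.castRingHom K (B₀.coeff 0) ≠ 0 := (hc.map (Int.castRingHom K)).ne_zero
    rw [← count_roots, Polynomial.map_mul, map_C, roots_C_mul _ hc', hmap, roots_prod _ _ hne,
      Multiset.count_bind]
    have hcount : ∀ k ∈ n.divisors, Multiset.count w (cyclotomic k K ^ m k).roots =
        if IsPrimitiveRoot w k then M w else 0 := by
      intro k hk
      have hk0 : k ≠ 0 := (Nat.pos_of_mem_divisors hk).ne'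
      have : NeZero (k : K) := ⟨Nat.cast_ne_zero.2 hk0⟩
      rw [roots_pow, Multiset.count_nsmul, cyclotomic.roots_eq_primitiveRoots_val,
        Multiset.count_eq_of_nodup (primitiveRoots k K).nodup]
      simp only [Finset.mem_val, mem_primitiveRoots (Nat.pos_of_ne_zero hk0)]
      split_ifs with h
      · rw [mul_one, hm' k w hk0 h]
      · rw [mul_zero]
    change ∑ k ∈ n.divisors, _ = _
    rw [Finset.sum_congr rfl hcount]
    by_cases hw : w ^ n = 1
    · rw [Finset.sum_eq_single (orderOf w)]
      · rw [if_pos (IsPrimitiveRoot.orderOf w)]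
      · intro k _ hk
        exact if_neg fun h => hk h.eq_orderOf
      · intro h
        exact absurd (Nat.mem_divisors.2 ⟨orderOf_dvd_of_pow_eq_one hw, hn⟩) h
    · rw [h0 w hw]
      simp

end Divisibility

/-! ### Determinants, eigenspaces and the conclusion -/

section MainTheorem

variable {K G Y : Type*} [Field K] [Group G] [AddCommGroup Y] [Module K Y]
  (ρ : Representation K G Y)

/-- Primitive roots of the same order are powers of each other, so this makes the maximal eigenspace
dimension depend only on the order of `w`. -/
theorem eigenspace_le_eigenspace_pow (g : G) (w : K) (i : ℕ) :
    Module.End.eigenspace (ρ g) w ≤ Module.End.eigenspace (ρ (g ^ i)) (w ^ i) := by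
  intro v hv
  rw [Module.End.mem_eigenspace_iff] at hv ⊢
  induction i with
  | zero => simp
  | succ i ih =>
    rw [pow_succ, map_mul, Module.End.mul_apply, hv, map_smul, ih, smul_smul, pow_succ, mul_comm]

theorem detOneSub_eq_charpolyRev {ι : Type*} [Fintype ι] [DecidableEq ι]
    (b : Module.Basis ι K Y) (g : G) :
    detOneSub ρ g = (LinearMap.toMatrix b b (ρ g)).charpolyRev := by
  set b' := Algebra.TensorProduct.basis K[X] b
  have h : LinearMap.toMatrix b' b' (LinearMap.id - (X : K[X]) • (ρ g).baseChange K[X]) =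
        1 - (X : K[X]) • (LinearMap.toMatrix b b (ρ g)).map C := by
    refine (_root_.map_sub (LinearMap.toMatrix b' b') _ _).trans ?_
    rw [LinearMap.toMatrix_id, LinearEquiv.map_smul, LinearMap.toMatrix_baseChange]
    rfl
  rw [detOneSub, ← LinearMap.det_toMatrix b', Matrix.charpolyRev, h]

variable [FiniteDimensional K Y]

theorem detOneSub_ne_zero (g : G) : detOneSub ρ g ≠ 0 := by
  intro h
  have h1 := Matrix.eval_charpolyRev
    (M := LinearMap.toMatrix (Module.finBasis K Y) (Module.finBasis K Y) (ρ g))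
  rw [← detOneSub_eq_charpolyRev, h, eval_zero] at h1
  exact zero_ne_one h1

/-- Up to a nonzero constant, `det (id - t g)` is the characteristic polynomial of `g⁻¹`. That
element is killed by the separable `X ^ |G| - 1`, so algebraic and geometric multiplicities agree.
-/
theorem rootMultiplicity_detOneSub [CharZero K] [Finite G] (g : G) (w : K) :
    rootMultiplicity w (detOneSub ρ g) =
      Module.finrank K (Module.End.eigenspace (ρ g⁻¹) w) := by
  have hss : Module.End.IsSemisimple (ρ g⁻¹) := by
    refine Module.End.isSemisimple_of_squarefree_aeval_eq_zero (p := X ^ Nat.card G - 1)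
      (X_pow_sub_one_separable_iff.2 (Nat.cast_ne_zero.2 Nat.card_pos.ne')).squarefree ?_
    rw [map_sub, map_pow, aeval_X, map_one, ← map_pow, pow_card_eq_one', map_one, sub_self]
  rw [← hss.isFinitelySemisimple.maxGenEigenspace_eq_eigenspace,
    LinearMap.finrank_maxGenEigenspace_eq]
  set b := Module.finBasis K Y
  set A := LinearMap.toMatrix b b (ρ g)
  set A' := LinearMap.toMatrix b b (ρ g⁻¹)
  have hA : A' * A = 1 := by
    rw [← LinearMap.toMatrix_mul, ← map_mul, inv_mul_cancel, map_one, LinearMap.toMatrix_one]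
  have hinv : A⁻¹ = A' := Matrix.inv_eq_left_inv hA
  have hunit : IsUnit A := IsUnit.of_mul_eq_one_right _ hA
  rw [← LinearMap.charpoly_toMatrix (ρ g⁻¹) b, show LinearMap.toMatrix b b (ρ g⁻¹) = A' from rfl,
    ← hinv, Matrix.charpoly_inv A hunit,
    detOneSub_eq_charpolyRev ρ b]
  have hne : A.charpolyRev ≠ 0 := detOneSub_eq_charpolyRev ρ b g ▸ detOneSub_ne_zero ρ g
  have hc : ((-1) ^ Fintype.card (Fin (Module.finrank K Y)) : K[X]) * C (Ring.inverse A.det) =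
      C ((-1) ^ Fintype.card (Fin (Module.finrank K Y)) * Ring.inverse A.det) := by
    simp
  have hc0 : ((-1) ^ Fintype.card (Fin (Module.finrank K Y)) * Ring.inverse A.det : K) ≠ 0 := by
    refine mul_ne_zero (pow_ne_zero _ (neg_ne_zero.2 one_ne_zero)) ?_
    rw [Ring.inverse_eq_inv']
    exact inv_ne_zero ((Matrix.isUnit_iff_isUnit_det A).1 hunit).ne_zero
  rw [hc, rootMultiplicity_mul (mul_ne_zero (C_ne_zero.2 hc0) hne), rootMultiplicity_C, zero_add]

theorem finrank_eigenspace_eq_zero [Finite G] (g : G) {w : K} (hw : w ^ Nat.card G ≠ 1) :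
    Module.finrank K (Module.End.eigenspace (ρ g) w) = 0 := by
  rw [Submodule.finrank_eq_zero, eq_bot_iff]
  intro v hv
  have h1 := eigenspace_le_eigenspace_pow ρ g w (Nat.card G) hv
  rw [pow_card_eq_one', map_one, Module.End.mem_eigenspace_iff, Module.End.one_apply] at h1
  have h2 : (1 - w ^ Nat.card G) • v = 0 := by rw [sub_smul, one_smul, ← h1, sub_self]
  exact (smul_eq_zero.1 h2).resolve_left (sub_ne_zero.2 (Ne.symm hw))

end MainTheorem

theorem mainTheorem4 {K G Y : Type*} [Field K] [IsAlgClosed K] [CharZero K]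
    [Group G] [Finite G] [AddCommGroup Y] [Module K Y] [FiniteDimensional K Y]
    (ρ : Representation K G Y) :
    ∃ B : ℤ[X], IsUniversalDenominator (invariantRingDegree ρ) B ∧
      IsLeastCommonMultiple (Set.range (detOneSub ρ)) (B.map (Int.castRingHom K)) := by
  have := Fintype.ofFinite G
  have hinj : Function.Injective (Int.castRingHom K) := Int.cast_injective
  set M : K → ℕ := fun w =>
    Finset.univ.sup fun g : G => Module.finrank K (Module.End.eigenspace (ρ g) w) with hMdef
  have hM : ∀ w g, Module.finrank K (Module.End.eigenspace (ρ g) w) ≤ M w := fun w g =>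
    Finset.le_sup (f := fun g : G => Module.finrank K (Module.End.eigenspace (ρ g) w))
      (Finset.mem_univ g)
  have hMle : ∀ k w w', k ≠ 0 → IsPrimitiveRoot w k → IsPrimitiveRoot w' k → M w ≤ M w' := by
    intro k w w' hk hw hw'
    have : NeZero k := ⟨hk⟩
    obtain ⟨i, -, -, rfl⟩ := (hw.isPrimitiveRoot_iff).1 hw'
    exact Finset.sup_le fun g _ => 
      (Submodule.finrank_mono (eigenspace_le_eigenspace_pow ρ g w i)).trans (hM _ _)
  obtain ⟨B, hBu, hB0, hB⟩ := exists_int_polynomial_rootMultiplicity M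
    (n := Nat.card G) Nat.card_pos.ne'
    (fun w hw => Nat.le_zero.1 (Finset.sup_le fun g _ => (finrank_eigenspace_eq_zero ρ g hw).le))
    (fun k w w' hk hw hw' => le_antisymm (hMle k w w' hk hw hw') (hMle k w' w hk hw' hw))
  have hBne : B ≠ 0 := leadingCoeff_ne_zero.1 hBu.ne_zero
  have hBmap : B.map (Int.castRingHom K) ≠ 0 := (Polynomial.map_ne_zero_iff hinj).2 hBne
  refine ⟨B, ⟨⟨hB0, fun I hI => ?_⟩, fun B' hB' => ?_⟩, ?_, fun q hq => ?_⟩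
  -- Any denominator `D` with unit leading coefficient serves to write `H(I, t)` as `P / D`; the
  -- choice `w = 1` is immaterial. One then shows that `D` divides `B * P` over `ℤ`.
  · obtain ⟨D, hDu, -, hD⟩ := exists_denominator ρ 1 (M 1) (hM 1)
    have hDne : D ≠ 0 := leadingCoeff_ne_zero.1 hDu.ne_zero
    obtain ⟨P, hP⟩ := hD I hI
    have hdvd : D ∣ B * P := by
      refine dvd_of_rootMultiplicity_map_le (K := K) hDu fun hBP w => ?_
      have hPne : P ≠ 0 := right_ne_zero_of_mul hBP
      -- A second denominator adapted to `w`: from `D * P' = D' * P` the order of `D` at `w` is at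
      -- most `M w` plus that of `P`, which is the order of `B * P`.
      obtain ⟨D', hDu', hm', hD'⟩ := exists_denominator ρ w (M w) (hM w)
      have hDne' : D' ≠ 0 := leadingCoeff_ne_zero.1 hDu'.ne_zero
      obtain ⟨P', hP'⟩ := hD' I hI
      have heq : D * P' = D' * P := by
        apply Polynomial.coe_injective
        rw [Polynomial.coe_mul, Polynomial.coe_mul, ← hP, ← hP']
        ring
      have hne : (D' * P).map (Int.castRingHom K) ≠ 0 :=
        (Polynomial.map_ne_zero_iff hinj).2 (mul_ne_zero hDne' hPne)
      have hne' : (B * P).map (Int.castRingHom K) ≠ 0 := (Polynomial.map_ne_zero_iff hinj).2 hBP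
      have h1 := congrArg (fun p => rootMultiplicity w (p.map (Int.castRingHom K))) heq
      have hne'' := hne
      rw [← heq] at hne''
      simp only [Polynomial.map_mul] at h1 hne hne' hne'' ⊢
      rw [rootMultiplicity_mul hne, rootMultiplicity_mul hne''] at h1
      rw [rootMultiplicity_mul hne', hB w]
      omega
    obtain ⟨Q, hQ⟩ := hdvd
    refine ⟨Q, ?_⟩
    have hDne' : (D : PowerSeries ℤ) ≠ 0 := fun h => hDne (Polynomial.coe_eq_zero_iff.1 h)
    apply mul_left_cancel₀ hDne'
    rw [mul_left_comm, hP, ← Polynomial.coe_mul, ← Polynomial.coe_mul, hQ]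
  · refine dvd_of_rootMultiplicity_map_le (K := K) hBu fun _ w => ?_
    rw [hB w]
    exact Finset.sup_le fun g _ => finrank_eigenspace_le_rootMultiplicity ρ g w hB'
  · rintro _ ⟨g, rfl⟩
    refine dvd_of_rootMultiplicity_le (detOneSub_ne_zero ρ g) fun _ w => ?_
    rw [rootMultiplicity_detOneSub, hB w]
    exact hM w g⁻¹
  · refine dvd_of_rootMultiplicity_le hBmap fun hq0 w => ?_
    rw [hB w]
    refine Finset.sup_le fun g _ => ?_
    have h1 := rootMultiplicity_le_rootMultiplicity_of_dvd hq0 (hq _ ⟨g⁻¹, rfl⟩) w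
    rwa [rootMultiplicity_detOneSub, inv_inv] at h1
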